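/- For positive integers $s_1,\dots,s_d$ and signs $z_1,\dots,z_d\in\{\pm1\}$ with $(s_1,z_1)\neq(1,1)$ (the admissible indices) let $$\zeta(s_1,\dots,s_d;z_1,\dots,z_d)=\lim_{M\to\infty}\sum_{M\ge n_1>\cdots>n_d>0}\frac{z_1^{n_1}\cdots z_d^{n_d}}{n_1^{s_1}\cdots n_d^{s_d}}$$ be the Euler sum, written $\zeta(s_1,\dots,s_d)$ with a bar over $s_j$ whenever $z_j=-1$. Let $\zeta_*\in\mathbb R[T]$ denote the $*$-regularized Euler sums, i.e. the unique extension of $\zeta$ to all indices with values in $\mathbb R[T]$ that is multiplicative for the stuffle product and satisfies $\zeta_*(1)=T$. Let $w\ge 4$, $u=w-2$, $v=w-1$, and let $\sum$ denote the sum over all pairs of positive integers $(a,c)$ with $a+c=w-1$. Then the following identities hold (those involving $\zeta_*$ as identities in $\mathbb R[T]$): \begin{align*} \sum\zeta_*(a,1,c)&=\zeta_*(1,1,u)+\zeta(v,1)+\zeta(2,u),\\ \sum\zeta_*(a,\bar1,\bar c)&=\zeta_*(1,\bar1,\bar u)+\zeta(\bar1,\bar u,\bar1)-\zeta(\bar1,\bar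 u,1)+\zeta(v,\bar1)+\zeta(\bar2,\bar u),\\ \sum\zeta(\bar a,\bar1,c)&=\zeta(\bar1,\bar1,\bar u)+\zeta(2,\bar u)+\zeta(\bar v,\bar1),\\ \sum\zeta(\bar a,1,\bar c)&=\zeta(\bar1,u,1)+\zeta(\bar1,1,u)-\zeta(\bar1,u,\bar1)+\zeta(\bar v,1)+\zeta(\bar2,u),\\ \sum\zeta(\bar a,1,c)&=\zeta(\bar1,\bar1,\bar u)+2\zeta(\bar v,1)+\zeta(\bar1,v)-\zeta(\bar1,\bar v)-\zeta(\bar v,\bar1)-\zeta(\bar u,2)-\zeta(w),\\ \sum\zeta_*(a,1,\bar c)&=\zeta(\bar u,\bar1,\bar1)-\zeta(\bar u,\bar1,1)+\zeta_*(1,1,\bar u)-\zeta(\bar v,\bar1)+\zeta(v,\bar1)\\ &\quad+2\zeta(\bar v,\bar1)-\zeta(\bar v,1)-\zeta(\bar u,\bar2)+\zeta(2)\zeta(\bar u)-\zeta(\bar w),\\ \sum\zeta_*(a,\bar1,c)&=2\zeta(u,\bar1,\bar1)-2\zeta(u,\bar1,1)+\zeta(\bar1,1,u)+\zeta_*(1,\bar1,u)-\zeta(\bar1,\bar1,u)+\zeta(\bar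 v,\bar1)\\ &\quad+\zeta(v,\bar1)+\zeta(\bar1,v)-\zeta(\bar v,1)-\zeta(\bar1,\bar v)-\zeta(2,u)-2\zeta(u,\bar2)-\zeta(\bar w)-\zeta(w),\\ \sum\zeta(\bar a,\bar1,\bar c)&=3\zeta(u,\bar1,1)-3\zeta(u,\bar1,\bar1)+\zeta(\bar1,\bar1,u)+2\zeta(\bar v,1)-\zeta(\bar v,\bar1)+\zeta(u,\bar2)+\zeta(2,u)-\zeta(u,2). \end{align*} -/

import Mathlib

open Finset Filter Topology Polynomial

/-- A signed exponent `(s, z)`: an exponent `s` together with a sign `z = ±1`.  An index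
`(s₁, …, s_d; z₁, …, z_d)` is the list of its signed exponents, outermost entry first. -/
abbrev SignedExp := ℕ × ℤˣ

/-- The unbarred entry `s`, with sign `+1`. -/
abbrev pl (s : ℕ) : SignedExp := (s, 1)

/-- The barred entry `s̄`, with sign `-1`. -/
abbrev bar (s : ℕ) : SignedExp := (s, -1)

/-- The truncated Euler sum
`∑_{M ≥ n₁ > ⋯ > n_d > 0} z₁ ^ n₁ ⋯ z_d ^ n_d / (n₁ ^ s₁ ⋯ n_d ^ s_d)`. -/
noncomputable def eulerTrunc : ℕ → List SignedExp → ℝ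
  | _, [] => 1
  | M, (s, z) :: l =>
      ∑ n ∈ Finset.Icc 1 M, (((z : ℤ) : ℝ) ^ n / (n : ℝ) ^ s) * eulerTrunc (n - 1) l

/-- The Euler sum `ζ(s₁, …, s_d; z₁, …, z_d)`, the limit of its truncations.  The limit exists for
every admissible index, see `tendsto_eulerTrunc`. -/
noncomputable def eulerSum (l : List SignedExp) : ℝ :=
  limUnder atTop fun M : ℕ => eulerTrunc M l

/-- The list (with multiplicities) of the indices in the stuffle (quasi-shuffle) product of two
indices. -/
def stuffle : List SignedExp → List SignedExp → List (List SignedExp)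
  | [], l => [l]
  | k, [] => [k]
  | a :: k, b :: l =>
      (stuffle k (b :: l)).map (a :: ·) ++ (stuffle (a :: k) l).map (b :: ·) ++
        (stuffle k l).map ((a.1 + b.1, a.2 * b.2) :: ·)
  termination_by k l => k.length + l.length

/-- The number of leading entries equal to the unbarred `1`. -/
def leadingOnes : List SignedExp → ℕ
  | [] => 0
  | a :: l => if a = pl 1 then leadingOnes l + 1 else 0

theorem length_or_leadingOnes_of_mem_stuffle (l : List SignedExp) :
    ∀ x ∈ stuffle [pl 1] l, x = pl 1 :: l ∨ x.length < l.length + 1 ∨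
      (x.length = l.length + 1 ∧ leadingOnes x ≤ leadingOnes l) := by
  induction l with
  | nil => intro x hx; simp [stuffle] at hx; exact Or.inl hx
  | cons b l ih =>
    intro x hx
    simp only [stuffle, List.map_cons, List.map_nil, List.mem_append, List.mem_map,
      List.mem_singleton] at hx
    rcases hx with (rfl | ⟨y, hy, rfl⟩) | rfl
    · exact Or.inl rfl
    · by_cases hb : b = pl 1
      · rcases ih y hy with rfl | h | ⟨h1, h2⟩
        · left; rw [hb]
        · right; left; simpa using h
        · right; right; simp [leadingOnes, hb, h1, h2]
      · rcases ih y hy with rfl | h | ⟨h1, h2⟩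
        · right; right; simp [leadingOnes, hb]
        · right; left; simpa using h
        · right; right; simp [leadingOnes, hb, h1]
    · right; left; simp

/-- The `∗`-regularized Euler sum `ζ_∗(s₁, …, s_d; z₁, …, z_d)`, a polynomial in `T` (here `X`):
the extension of `eulerSum` from admissible to all indices that respects the stuffle product and
has `ζ_∗(1) = T`.  If `w = (1, l)` starts with exactly `k ≥ 1` unbarred ones, then `w` occurs `k`
times in the stuffle product of `(1)` and `l`, so `T ζ_∗(l) = k ζ_∗(w) + ∑ ζ_∗(x)` over the
remaining indices `x` of that product, which determines `ζ_∗(w)`. -/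
noncomputable def regStar : List SignedExp → ℝ[X]
  | [] => 1
  | a :: l =>
    if ha : a = pl 1 then
      C (1 / (leadingOnes (a :: l) : ℝ)) *
        (X * regStar l -
          (((stuffle [pl 1] l).filter (fun x => x ≠ a :: l)).attach.map
            (fun x => regStar x.1)).sum)
    else C (eulerSum (a :: l))
  termination_by w => (w.length, leadingOnes w)
  decreasing_by
    · simp [Prod.lex_def]
    · have h := x.2
      simp only [List.mem_filter, decide_eq_true_eq] at h
      rcases length_or_leadingOnes_of_mem_stuffle l x.1 h.1 with h' | h' | ⟨h1, h2⟩
      · exact absurd (h'.trans (by rw [ha])) h.2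
      · simp only [Prod.lex_def, List.length_cons]; exact Or.inl h'
      · simp only [Prod.lex_def, List.length_cons, leadingOnes, ha, if_true]
        exact Or.inr ⟨h1, by omega⟩

/-- The pairs `(a, c)` of positive integers with `a + c = n`. -/
def posPairs (n : ℕ) : Finset (ℕ × ℕ) :=
  (Finset.HasAntidiagonal.antidiagonal n).filter fun p => 1 ≤ p.1 ∧ 1 ≤ p.2

theorem eulerTrunc_succ (M : ℕ) (s : ℕ) (z : ℤˣ) (l : List SignedExp) :
    eulerTrunc (M + 1) ((s, z) :: l) = eulerTrunc M ((s, z) :: l) +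
      (((z : ℤ) : ℝ) ^ (M + 1) / ((M : ℝ) + 1) ^ s) * eulerTrunc M l := by
  simp only [eulerTrunc]
  rw [Finset.sum_Icc_succ_top (by omega)]
  simp

theorem eulerTrunc_zero (a : SignedExp) (l : List SignedExp) : eulerTrunc 0 (a :: l) = 0 := by
  simp [eulerTrunc]

theorem abs_sign_pow_div_le (M s : ℕ) (hs : 1 ≤ s) (z : ℤˣ) :
    |((z : ℤ) : ℝ) ^ (M + 1) / ((M : ℝ) + 1) ^ s| ≤ 1 / ((M : ℝ) + 1) := by
  have hz : |((z : ℤ) : ℝ)| = 1 := by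
    rcases Int.units_eq_one_or z with rfl | rfl <;> simp
  have hM : (1 : ℝ) ≤ (M : ℝ) + 1 := by linarith [Nat.cast_nonneg (α := ℝ) M]
  rw [abs_div, abs_pow, hz, one_pow, abs_of_nonneg (by positivity)]
  have : (M : ℝ) + 1 ≤ ((M : ℝ) + 1) ^ s := le_self_pow₀ hM (by omega)
  gcongr

theorem harmonic_cast_nonneg (M : ℕ) : (0 : ℝ) ≤ (harmonic M : ℝ) := by
  rw [harmonic]; push_cast; positivity

theorem harmonic_cast_succ (M : ℕ) :
    (harmonic (M + 1) : ℝ) = (harmonic M : ℝ) + 1 / ((M : ℝ) + 1) := by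
  rw [harmonic_succ]; push_cast; simp

theorem harmonic_cast_one_le (M : ℕ) : (1 : ℝ) ≤ (harmonic (M + 1) : ℝ) := by
  induction M with
  | zero => simp [harmonic]
  | succ M ih => rw [harmonic_cast_succ]; have : (0 : ℝ) ≤ 1 / (((M + 1 : ℕ) : ℝ) + 1) := by positivity
                 linarith

theorem abs_eulerTrunc_le (l : List SignedExp) (hl : ∀ a ∈ l, 1 ≤ a.1) (M : ℕ) :
    |eulerTrunc M l| ≤ (harmonic M : ℝ) ^ l.length := by
  induction l generalizing M with
  | nil => simp [eulerTrunc]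
  | cons a l ih =>
    obtain ⟨s, z⟩ := a
    have hs : 1 ≤ s := hl (s, z) (by simp)
    have ih' := ih (fun a ha => hl a (by simp [ha]))
    induction M with
    | zero => simp [eulerTrunc_zero, harmonic]
    | succ M ihM =>
      rw [eulerTrunc_succ]
      have h1 := abs_sign_pow_div_le M s hs z
      have h0 := harmonic_cast_nonneg M
      have hd : (0 : ℝ) ≤ 1 / ((M : ℝ) + 1) := by positivity
      have hle : (harmonic M : ℝ) ^ l.length ≤ (harmonic (M + 1) : ℝ) ^ l.length := by
        apply pow_le_pow_left₀ h0; rw [harmonic_cast_succ]; linarith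
      calc _ ≤ |eulerTrunc M ((s, z) :: l)| +
            |((z : ℤ) : ℝ) ^ (M + 1) / ((M : ℝ) + 1) ^ s| * |eulerTrunc M l| := by
              rw [← abs_mul]; exact abs_add_le _ _
        _ ≤ (harmonic M : ℝ) ^ (l.length + 1) +
            1 / ((M : ℝ) + 1) * (harmonic M : ℝ) ^ l.length := by
              gcongr
              · simpa using ihM
              · exact ih' M
        _ = (harmonic M : ℝ) ^ l.length * (harmonic (M + 1) : ℝ) := by
              rw [harmonic_cast_succ]; ring
        _ ≤ (harmonic (M + 1) : ℝ) ^ l.length * (harmonic (M + 1) : ℝ) := by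
              gcongr; exact harmonic_cast_nonneg _
        _ = _ := by simp [pow_succ]

theorem harmonic_pow_isLittleO (d : ℕ) (ε : ℝ) (hε : 0 < ε) :
    (fun M : ℕ => (harmonic (M + 1) : ℝ) ^ d) =o[atTop] fun M : ℕ => ((M : ℝ) + 1) ^ ε := by
  have hlog : (fun x : ℝ => (2 * Real.log x) ^ d) =o[atTop] fun x : ℝ => x ^ ε := by
    have := (isLittleO_log_rpow_rpow_atTop (d : ℝ) hε).const_mul_left (2 ^ d)
    simpa [mul_pow] using this
  have ht : Tendsto (fun M : ℕ => (M : ℝ) + 1) atTop atTop :=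
    tendsto_atTop_add_const_right _ _ tendsto_natCast_atTop_atTop
  refine Asymptotics.IsBigO.trans_isLittleO (g := fun M : ℕ => (2 * Real.log ((M : ℝ) + 1)) ^ d)
    ?_ (hlog.comp_tendsto ht)
  refine Asymptotics.IsBigO.of_bound 1 ?_
  have h1 : ∀ᶠ M : ℕ in atTop, (1 : ℝ) ≤ Real.log ((M : ℝ) + 1) :=
    (Real.tendsto_log_atTop.comp ht).eventually_ge_atTop 1
  filter_upwards [h1] with M hM
  have h2 := harmonic_le_one_add_log (M + 1)
  push_cast at h2
  have h0 := harmonic_cast_nonneg (M + 1)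
  rw [Real.norm_of_nonneg (by positivity), Real.norm_of_nonneg (by positivity), one_mul]
  gcongr
  linarith

theorem summable_harmonic_pow_div_sq (d : ℕ) :
    Summable fun M : ℕ => (harmonic (M + 1) : ℝ) ^ d / ((M : ℝ) + 1) ^ 2 := by
  have h32 : Summable fun M : ℕ => 1 / ((M : ℝ) + 1) ^ ((3 : ℝ) / 2) := by
    have := (summable_nat_add_iff 1).2 (Real.summable_one_div_nat_rpow.2
      (show (1 : ℝ) < 3 / 2 by norm_num))
    simpa using this
  refine summable_of_isBigO_nat h32 ?_
  have h := (harmonic_pow_isLittleO d (1 / 2) (by norm_num)).isBigO.mul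
    (Asymptotics.isBigO_refl (fun M : ℕ => (((M : ℝ) + 1) ^ 2)⁻¹) atTop)
  refine h.congr_right ?_ |>.congr_left ?_
  · intro M
    have hM : (0 : ℝ) < (M : ℝ) + 1 := by positivity
    rw [← Real.rpow_natCast, ← Real.rpow_neg hM.le, ← Real.rpow_add hM,
      one_div (((M : ℝ) + 1) ^ ((3 : ℝ) / 2)), ← Real.rpow_neg hM.le]
    norm_num
  · intro M; rw [div_eq_mul_inv]

/-- Truncated Euler sums converge for every admissible index: all exponents positive and the
first entry different from the unbarred `1` (the empty index is included). -/
theorem tendsto_eulerTrunc (l : List SignedExp) (hl : ∀ a ∈ l, 1 ≤ a.1)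
    (h1 : l.head? ≠ some (pl 1)) :
    Tendsto (fun M : ℕ => eulerTrunc M l) atTop (𝓝 (eulerSum l)) := by
  suffices h : ∃ x, Tendsto (fun M : ℕ => eulerTrunc M l) atTop (𝓝 x) from
    tendsto_nhds_limUnder h
  match l with
  | [] => exact ⟨1, by simp [eulerTrunc]⟩
  | (s, z) :: l =>
  have hs : 1 ≤ s := hl (s, z) (by simp)
  have hl' : ∀ a ∈ l, 1 ≤ a.1 := fun a ha => hl a (by simp [ha])
  have hmono : ∀ M d : ℕ, (harmonic M : ℝ) ^ d ≤ (harmonic (M + 1) : ℝ) ^ d := fun M d => by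
    apply pow_le_pow_left₀ (harmonic_cast_nonneg M)
    rw [harmonic_cast_succ]
    have : (0 : ℝ) ≤ 1 / ((M : ℝ) + 1) := by positivity
    linarith
  have hb : ∀ M, |eulerTrunc M l| ≤ (harmonic (M + 1) : ℝ) ^ l.length := fun M =>
    (abs_eulerTrunc_le l hl' M).trans (hmono M _)
  have hz : |((z : ℤ) : ℝ)| = 1 := by
    rcases Int.units_eq_one_or z with rfl | rfl <;> simp
  have hsum : ∀ M, eulerTrunc M ((s, z) :: l) = ∑ n ∈ Finset.range M,
      (((z : ℤ) : ℝ) ^ (n + 1) / ((n : ℝ) + 1) ^ s) * eulerTrunc n l := by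
    intro M
    induction M with
    | zero => simp [eulerTrunc_zero]
    | succ M ih => rw [eulerTrunc_succ, ih, Finset.sum_range_succ]
  by_cases hs2 : 2 ≤ s
  · have : Summable fun n : ℕ =>
        (((z : ℤ) : ℝ) ^ (n + 1) / ((n : ℝ) + 1) ^ s) * eulerTrunc n l := by
      refine Summable.of_norm_bounded (summable_harmonic_pow_div_sq l.length) fun n => ?_
      have hn : (1 : ℝ) ≤ (n : ℝ) + 1 := by linarith [Nat.cast_nonneg (α := ℝ) n]
      rw [Real.norm_eq_abs, abs_mul, abs_div, abs_pow, hz, one_pow,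
        abs_of_nonneg (by positivity : (0 : ℝ) ≤ ((n : ℝ) + 1) ^ s), div_mul_eq_mul_div, one_mul]
      have : ((n : ℝ) + 1) ^ 2 ≤ ((n : ℝ) + 1) ^ s := pow_le_pow_right₀ hn hs2
      have := hb n
      have h0 := harmonic_cast_nonneg (n + 1)
      gcongr
    refine ⟨∑' n : ℕ, (((z : ℤ) : ℝ) ^ (n + 1) / ((n : ℝ) + 1) ^ s) * eulerTrunc n l, ?_⟩
    simpa only [hsum] using this.hasSum.tendsto_sum_nat
  · have hs1 : s = 1 := by omega
    subst hs1
    have hz1 : z = -1 := by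
      rcases Int.units_eq_one_or z with rfl | rfl
      · simp at h1
      · rfl
    subst hz1
    set f : ℕ → ℝ := fun n => eulerTrunc n l / ((n : ℝ) + 1) with hf
    have hid : ∀ M, eulerTrunc M ((1, -1) :: l) =
        (∑ n ∈ Finset.range M, (-1 : ℝ) ^ (n + 1) * (f n - f (n + 1)) - f 0
          + (-1) ^ M * f M) / 2 := by
      intro M
      induction M with
      | zero => simp [eulerTrunc_zero]
      | succ M ih =>
        rw [eulerTrunc_succ, ih, Finset.sum_range_succ]
        have : eulerTrunc M l / ((M : ℝ) + 1) = f M := rfl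
        simp only [Units.val_neg, Units.val_one, Int.cast_neg, Int.cast_one, pow_one]
        rw [div_mul_eq_mul_div, mul_div_assoc, this]
        ring
    have hdiff : ∀ n, |eulerTrunc (n + 1) l - eulerTrunc n l| ≤
        (harmonic (n + 1) : ℝ) ^ l.length / ((n : ℝ) + 1) := by
      intro n
      have h0 := harmonic_cast_nonneg (n + 1)
      match l with
      | [] => simp [eulerTrunc]; positivity
      | (s', z') :: l' =>
        rw [eulerTrunc_succ, add_sub_cancel_left, abs_mul]
        have e1 := abs_sign_pow_div_le n s' (hl' (s', z') (by simp)) z'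
        have e2 := (abs_eulerTrunc_le l' (fun a ha => hl' a (by simp [ha])) n).trans (hmono n _)
        have e3 : (harmonic (n + 1) : ℝ) ^ l'.length ≤ (harmonic (n + 1) : ℝ) ^ (l'.length + 1) :=
          pow_le_pow_right₀ (harmonic_cast_one_le n) (by omega)
        calc _ ≤ 1 / ((n : ℝ) + 1) * (harmonic (n + 1) : ℝ) ^ (l'.length + 1) := by
              gcongr; exact e2.trans e3
          _ = _ := by rw [List.length_cons]; ring
    have hsm : Summable fun n : ℕ => (-1 : ℝ) ^ (n + 1) * (f n - f (n + 1)) := by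
      refine Summable.of_norm_bounded
        ((summable_harmonic_pow_div_sq l.length).mul_left 2) fun n => ?_
      have hn : (0 : ℝ) < (n : ℝ) + 1 := by positivity
      have hn2 : (0 : ℝ) < (n : ℝ) + 2 := by positivity
      rw [Real.norm_eq_abs, abs_mul, abs_pow, abs_neg, abs_one, one_pow, one_mul]
      have e : f n - f (n + 1) = eulerTrunc n l / (((n : ℝ) + 1) * ((n : ℝ) + 2)) -
          (eulerTrunc (n + 1) l - eulerTrunc n l) / ((n : ℝ) + 2) := by
        simp only [hf]; push_cast; field_simp; ring
      rw [e]
      have h0 := harmonic_cast_nonneg (n + 1)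
      calc _ ≤ |eulerTrunc n l| / (((n : ℝ) + 1) * ((n : ℝ) + 2)) +
            |eulerTrunc (n + 1) l - eulerTrunc n l| / ((n : ℝ) + 2) := by
              refine (abs_sub _ _).trans ?_
              rw [abs_div, abs_div, abs_of_pos (mul_pos hn hn2), abs_of_pos hn2]
        _ ≤ (harmonic (n + 1) : ℝ) ^ l.length / (((n : ℝ) + 1) * ((n : ℝ) + 1)) +
            (harmonic (n + 1) : ℝ) ^ l.length / ((n : ℝ) + 1) / ((n : ℝ) + 1) := by
              have := hb n
              have := hdiff n
              have : (n : ℝ) + 1 ≤ (n : ℝ) + 2 := by linarith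
              gcongr
        _ = _ := by field_simp; ring
    have hf0 : Tendsto f atTop (𝓝 0) := by
      have h := (harmonic_pow_isLittleO l.length 1 one_pos).tendsto_div_nhds_zero
      refine squeeze_zero_norm (fun n => ?_) h
      have hn : (0 : ℝ) < (n : ℝ) + 1 := by positivity
      rw [Real.norm_eq_abs, abs_div, abs_of_pos hn, Real.rpow_one]
      have := hb n
      gcongr
    have hf1 : Tendsto (fun M : ℕ => (-1 : ℝ) ^ M * f M) atTop (𝓝 0) := by
      refine squeeze_zero_norm (fun n => ?_) (tendsto_zero_iff_norm_tendsto_zero.1 hf0)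
      simp
    refine ⟨((∑' n : ℕ, (-1 : ℝ) ^ (n + 1) * (f n - f (n + 1))) - f 0 + 0) / 2, ?_⟩
    simp only [hid]
    exact ((hsm.hasSum.tendsto_sum_nat.sub_const _).add hf1).div_const 2

/-!
In the truncated triple sum over `n > k > m`, the geometric sum over the exponents is
`∑ n⁻ᵃ⁻¹ m⁻ᶜ = m⁻ᵘ (1 / (n - m) - 1 / n) - n⁻ᵘ / (n - m)`, taken over `a + c = u`.

* In the part with `m⁻ᵘ`, the sum over `n` and `k` converges, as the truncation bound tends to
  infinity, to a combination of truncated sums of bound `m`; since it is `O(√m)` uniformly in the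
  bound, dominated convergence gives the sum over `m`.
* In the part with `n⁻ᵘ`, the sum over `k` and `m` is a truncated shuffle product of two sums of
  depth one, by partial fractions for `1 / (i j)` with `i + j` fixed.

This evaluates the sum over the first exponents `a + 1 ≥ 2`, for all signs at once, as a polynomial
in Euler sums. Stuffle products together with `ζ(bar 1)² = 2 ζ(bar 1, 1)` and
`2 ζ(bar 2) + ζ(2) = 0` turn it into the eight right-hand sides. Regularization affects
only the term with first exponent `1`, which occurs on both sides.
-/

/-- The summand `zⁿ / nˢ` that the signed exponent `(s, z)` contributes at `n`. -/
noncomputable def eulerTerm (a : SignedExp) (n : ℕ) : ℝ :=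
  ((a.2 : ℤ) : ℝ) ^ n / (n : ℝ) ^ a.1

theorem sign_cast_mul_self (z : ℤˣ) : ((z : ℤ) : ℝ) * ((z : ℤ) : ℝ) = 1 := by
  rcases Int.units_eq_one_or z with rfl | rfl <;> simp

theorem sign_pow_mul_self (z : ℤˣ) (n : ℕ) : ((z : ℤ) : ℝ) ^ n * ((z : ℤ) : ℝ) ^ n = 1 := by
  rw [← mul_pow, sign_cast_mul_self, one_pow]

theorem abs_sign_pow (z : ℤˣ) (n : ℕ) : |((z : ℤ) : ℝ) ^ n| = 1 := by
  rcases Int.units_eq_one_or z with rfl | rfl <;> simp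

theorem eulerTerm_mul (a b : SignedExp) (n : ℕ) :
    eulerTerm a n * eulerTerm b n = eulerTerm (a.1 + b.1, a.2 * b.2) n := by
  simp only [eulerTerm, Units.val_mul, Int.cast_mul, mul_pow, pow_add, div_mul_div_comm]

theorem sign_pow_mul_eulerTerm (x z : ℤˣ) (s n : ℕ) :
    ((x : ℤ) : ℝ) ^ n * eulerTerm (s, z) n = eulerTerm (s, x * z) n := by
  simp only [eulerTerm, Units.val_mul, Int.cast_mul, mul_pow, mul_div_assoc]

theorem mul_sign_pow_mul_eulerTerm (x z : ℤˣ) (s n : ℕ) :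
    (((x * z : ℤˣ) : ℤ) : ℝ) ^ n * eulerTerm (s, z) n = eulerTerm (s, x) n := by
  rw [sign_pow_mul_eulerTerm, mul_assoc, Int.units_mul_self, mul_one]

theorem eulerTerm_pl (s n : ℕ) : eulerTerm (pl s) n = 1 / (n : ℝ) ^ s := by
  simp only [eulerTerm, Units.val_one, Int.cast_one, one_pow]

theorem abs_eulerTerm (a : SignedExp) (n : ℕ) : |eulerTerm a n| = 1 / (n : ℝ) ^ a.1 := by
  rw [eulerTerm, abs_div, abs_sign_pow, abs_of_nonneg (by positivity)]

theorem eulerTrunc_nil (M : ℕ) : eulerTrunc M [] = 1 := by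
  simp only [eulerTrunc]

theorem eulerTrunc_succ_cons (M : ℕ) (a : SignedExp) (l : List SignedExp) :
    eulerTrunc (M + 1) (a :: l) = eulerTrunc M (a :: l) + eulerTerm a (M + 1) * eulerTrunc M l := by
  rw [eulerTrunc_succ, eulerTerm, Nat.cast_add_one]

theorem eulerTrunc_cons (M : ℕ) (a : SignedExp) (l : List SignedExp) :
    eulerTrunc M (a :: l) = ∑ n ∈ range M, eulerTerm a (n + 1) * eulerTrunc n l := by
  induction M with
  | zero => simp [eulerTrunc_zero]
  | succ M ih => rw [eulerTrunc_succ_cons, ih, sum_range_succ]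

theorem eulerTrunc_singleton (M : ℕ) (a : SignedExp) :
    eulerTrunc M [a] = ∑ n ∈ range M, eulerTerm a (n + 1) := by
  simp only [eulerTrunc_cons, eulerTrunc_nil, mul_one]

theorem eulerTrunc_succ_singleton (M : ℕ) (a : SignedExp) :
    eulerTrunc (M + 1) [a] = eulerTrunc M [a] + eulerTerm a (M + 1) := by
  rw [eulerTrunc_succ_cons, eulerTrunc_nil, mul_one]

theorem eulerTrunc_mul (k l : List SignedExp) (M : ℕ) :
    eulerTrunc M k * eulerTrunc M l = ((stuffle k l).map (eulerTrunc M)).sum := by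
  match k, l with
  | [], l => simp [stuffle, eulerTrunc_nil]
  | a :: k, [] => simp [stuffle, eulerTrunc_nil]
  | a :: k, b :: l =>
    induction M with
    | zero => simp [stuffle, eulerTrunc_zero, Function.comp_def]
    | succ M ih =>
      have hleft := eulerTrunc_mul k (b :: l) M
      have hright := eulerTrunc_mul (a :: k) l M
      have hboth := eulerTrunc_mul k l M
      rw [stuffle] at ih ⊢
      simp only [List.map_append, List.map_map, List.sum_append, Function.comp_def,
        eulerTrunc_succ_cons, List.sum_map_add, List.sum_map_mul_left] at ih ⊢
      rw [← hleft, ← hright, ← hboth, ← eulerTerm_mul]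
      linear_combination ih
termination_by k.length + l.length

/-- The indices whose Euler sum converges: all exponents are positive and the first entry is not
the unbarred `1`. -/
def Admissible (l : List SignedExp) : Prop :=
  (∀ a ∈ l, 1 ≤ a.1) ∧ l.head? ≠ some (pl 1)

theorem Admissible.tendsto {l : List SignedExp} (h : Admissible l) :
    Tendsto (fun M => eulerTrunc M l) atTop (𝓝 (eulerSum l)) :=
  tendsto_eulerTrunc l h.1 h.2

theorem admissible_cons {s : ℕ} (hs : 2 ≤ s) (z : ℤˣ) {l : List SignedExp}
    (hl : ∀ a ∈ l, 1 ≤ a.1) : Admissible ((s, z) :: l) := by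
  refine ⟨List.forall_mem_cons.2 ⟨by lia, hl⟩, ?_⟩
  simp only [List.head?_cons, ne_eq, Option.some.injEq, Prod.mk.injEq]
  lia

theorem admissible_bar_cons {l : List SignedExp} (hl : ∀ a ∈ l, 1 ≤ a.1) :
    Admissible (bar 1 :: l) :=
  ⟨List.forall_mem_cons.2 ⟨le_rfl, hl⟩, by simp⟩

theorem one_le_of_mem_stuffle {k l : List SignedExp} (hk : ∀ a ∈ k, 1 ≤ a.1)
    (hl : ∀ a ∈ l, 1 ≤ a.1) : ∀ x ∈ stuffle k l, ∀ a ∈ x, 1 ≤ a.1 := by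
  match k, l with
  | [], l => simpa [stuffle] using hl
  | a :: k, [] =>
    intro x hx
    simp only [stuffle, List.mem_singleton] at hx
    exact hx ▸ hk
  | a :: k, b :: l =>
    obtain ⟨ha, hk'⟩ := List.forall_mem_cons.1 hk
    obtain ⟨hb, hl'⟩ := List.forall_mem_cons.1 hl
    intro x hx
    rw [stuffle] at hx
    simp only [List.mem_append, List.mem_map] at hx
    rcases hx with (⟨t, ht, rfl⟩ | ⟨t, ht, rfl⟩) | ⟨t, ht, rfl⟩
    · exact List.forall_mem_cons.2 ⟨ha, one_le_of_mem_stuffle hk' hl t ht⟩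
    · exact List.forall_mem_cons.2 ⟨hb, one_le_of_mem_stuffle hk hl' t ht⟩
    · exact List.forall_mem_cons.2 ⟨by lia, one_le_of_mem_stuffle hk' hl' t ht⟩
termination_by k.length + l.length

theorem Admissible.of_mem_stuffle {k l : List SignedExp} (hk : Admissible k) (hl : Admissible l) :
    ∀ x ∈ stuffle k l, Admissible x := by
  refine fun x hx => ⟨one_le_of_mem_stuffle hk.1 hl.1 x hx, ?_⟩
  match k, l with
  | [], l =>
    simp only [stuffle, List.mem_singleton] at hx
    exact hx ▸ hl.2
  | a :: k, [] =>
    simp only [stuffle, List.mem_singleton] at hx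
    exact hx ▸ hk.2
  | a :: k, b :: l =>
    have ha := hk.1 a List.mem_cons_self
    have hb := hl.1 b List.mem_cons_self
    rw [stuffle] at hx
    simp only [List.mem_append, List.mem_map] at hx
    rcases hx with (⟨t, -, rfl⟩ | ⟨t, -, rfl⟩) | ⟨t, -, rfl⟩
    · exact hk.2
    · exact hl.2
    · simp only [List.head?_cons, ne_eq, Option.some.injEq, Prod.mk.injEq]
      lia

theorem eulerSum_mul {k l : List SignedExp} (hk : Admissible k) (hl : Admissible l) :
    eulerSum k * eulerSum l = ((stuffle k l).map eulerSum).sum := by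
  have hprod := hk.tendsto.mul hl.tendsto
  simp only [eulerTrunc_mul] at hprod
  refine tendsto_nhds_unique hprod ?_
  exact tendsto_list_sum _ fun x hx => (hk.of_mem_stuffle hl x hx).tendsto

theorem sum_antidiagonal_eulerTerm_fst (a : SignedExp) (N : ℕ) :
    ∑ p ∈ antidiagonal N, eulerTerm a (p.1 + 1) = eulerTrunc (N + 1) [a] := by
  rw [Nat.sum_antidiagonal_eq_sum_range_succ_mk, eulerTrunc_singleton]

theorem sum_antidiagonal_eulerTerm_mul_eulerTerm (y z : ℤˣ) (N : ℕ) :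
    ∑ p ∈ antidiagonal N, eulerTerm (1, y) (p.1 + 1) * eulerTerm (1, z) (p.2 + 1) =
      (eulerTerm (1, y) (N + 2) + eulerTerm (1, z) (N + 2)) * eulerTrunc (N + 1) [(1, y * z)] := by
  have partialFractions : ∀ p ∈ antidiagonal N,
      eulerTerm (1, y) (p.1 + 1) * eulerTerm (1, z) (p.2 + 1) =
        eulerTerm (1, y) (N + 2) * eulerTerm (1, y * z) (p.2 + 1) +
          eulerTerm (1, z) (N + 2) * eulerTerm (1, y * z) (p.1 + 1) := by
    rintro ⟨i, j⟩ hp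
    obtain rfl := mem_antidiagonal.1 hp
    have hy := sign_pow_mul_self y (j + 1)
    have hz := sign_pow_mul_self z (i + 1)
    simp only [eulerTerm, Units.val_mul, Int.cast_mul, mul_pow, pow_one,
      show i + j + 2 = (i + 1) + (j + 1) by ring, pow_add _ (i + 1) (j + 1)]
    push_cast
    have hinv : ((i : ℝ) + 1)⁻¹ * ((j : ℝ) + 1)⁻¹ =
        ((i : ℝ) + 1 + (j + 1))⁻¹ * (((i : ℝ) + 1)⁻¹ + ((j : ℝ) + 1)⁻¹) := by
      have : (i : ℝ) + 1 + (j + 1) ≠ 0 := by positivity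
      field_simp
      ring
    simp only [div_eq_mul_inv]
    set r := ((i : ℝ) + 1 + (j + 1))⁻¹
    linear_combination ((y : ℤ) : ℝ) ^ (i + 1) * ((z : ℤ) : ℝ) ^ (j + 1) *
      (hinv - r * ((i : ℝ) + 1)⁻¹ * hz - r * ((j : ℝ) + 1)⁻¹ * hy)
  have hfst := sum_antidiagonal_eulerTerm_fst (1, y * z) N
  have hsnd := hfst
  rw [← Nat.sum_antidiagonal_swap] at hsnd
  rw [sum_congr rfl partialFractions, sum_add_distrib, ← mul_sum, ← mul_sum, hfst, add_mul]
  exact congrArg (eulerTerm (1, y) (N + 2) * · + _) hsnd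

/-- A truncated form of the shuffle product of `(1; y)` and `(1; z)`. -/
theorem sum_antidiagonal_eulerTerm_mul_eulerTrunc (y z : ℤˣ) (N : ℕ) :
    ∑ p ∈ antidiagonal N, eulerTerm (1, y) (p.1 + 1) * eulerTrunc p.2 [(1, z)] =
      eulerTrunc (N + 1) [(1, y), (1, y * z)] + eulerTrunc (N + 1) [(1, z), (1, y * z)] := by
  induction N with
  | zero => simp [eulerTrunc_cons]
  | succ N ih =>
    rw [Nat.sum_antidiagonal_succ']
    simp only [eulerTrunc_succ_singleton, mul_add, sum_add_distrib]
    rw [ih, sum_antidiagonal_eulerTerm_mul_eulerTerm, eulerTrunc_zero,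
      eulerTrunc_succ_cons (N + 1) (1, y), eulerTrunc_succ_cons (N + 1) (1, z)]
    ring

theorem tendsto_eulerTrunc_succ_sub {l : List SignedExp} (hl : ∀ a ∈ l, 1 ≤ a.1) :
    Tendsto (fun N => eulerTrunc (N + 1) l - eulerTrunc N l) atTop (𝓝 0) := by
  match l with
  | [] => simp [eulerTrunc_nil]
  | (s, z) :: l =>
    obtain ⟨hs, hl⟩ := List.forall_mem_cons.1 hl
    refine squeeze_zero_norm (fun N => ?_)
      (harmonic_pow_isLittleO l.length 1 one_pos).tendsto_div_nhds_zero
    have hbound : |eulerTrunc N l| ≤ (harmonic (N + 1) : ℝ) ^ l.length := by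
      refine (abs_eulerTrunc_le l hl N).trans ?_
      refine pow_le_pow_left₀ (harmonic_cast_nonneg N) ?_ _
      rw [harmonic_cast_succ]
      exact le_add_of_nonneg_right (by positivity)
    rw [eulerTrunc_succ, add_sub_cancel_left, Real.norm_eq_abs, abs_mul, Real.rpow_one,
      ← one_div_mul_eq_div ((N : ℝ) + 1)]
    exact mul_le_mul (abs_sign_pow_div_le N s hs z) hbound (abs_nonneg _) (by positivity)

theorem tendsto_eulerTrunc_add_sub {l : List SignedExp} (hl : ∀ a ∈ l, 1 ≤ a.1) (m : ℕ) :
    Tendsto (fun N => eulerTrunc (m + N) l - eulerTrunc N l) atTop (𝓝 0) := by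
  induction m with
  | zero => simp
  | succ m ih =>
    have hstep := (tendsto_eulerTrunc_succ_sub hl).comp (tendsto_add_atTop_nat m)
    rw [← add_zero (0 : ℝ)]
    refine (hstep.add ih).congr fun N => ?_
    simp only [Function.comp_apply, add_comm N m, add_right_comm m N 1, sub_add_sub_cancel]

theorem eulerTrunc_two_mul (s M : ℕ) :
    2 ^ s * (eulerTrunc (2 * M) [pl s] + eulerTrunc (2 * M) [bar s]) =
      2 * eulerTrunc M [pl s] := by
  induction M with
  | zero => simp [eulerTrunc_zero]
  | succ M ih =>
    simp only [mul_add, mul_one, eulerTrunc_succ_singleton] at ih ⊢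
    have hodd : eulerTerm (bar s) (2 * M + 1) = -eulerTerm (pl s) (2 * M + 1) := by
      simp [eulerTerm, pow_succ, pow_mul, neg_div]
    have heven : eulerTerm (bar s) (2 * M + 1 + 1) = eulerTerm (pl s) (2 * M + 1 + 1) := by
      simp [eulerTerm, pow_succ, pow_mul]
    have hdouble : 2 ^ s * eulerTerm (pl s) (2 * M + 1 + 1) = eulerTerm (pl s) (M + 1) := by
      simp only [eulerTerm_pl,
        show 2 * M + 1 + 1 = 2 * (M + 1) by ring, Nat.cast_mul, Nat.cast_ofNat, mul_pow]
      field_simp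
    rw [hodd, heven]
    linear_combination ih + 2 * hdouble

theorem eulerSum_distribution {s : ℕ} (hs : 2 ≤ s) :
    2 ^ s * (eulerSum [pl s] + eulerSum [bar s]) = 2 * eulerSum [pl s] := by
  have hadm (z : ℤˣ) : Admissible [(s, z)] := admissible_cons hs z (by simp)
  have heven : Tendsto (fun M : ℕ => 2 * M) atTop atTop :=
    tendsto_id.const_mul_atTop' two_pos
  have hlim := (((hadm 1).tendsto.comp heven).add ((hadm (-1)).tendsto.comp heven)).const_mul
    ((2 : ℝ) ^ s)
  refine tendsto_nhds_unique hlim (((hadm 1).tendsto.const_mul 2).congr fun M => ?_)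
  exact (eulerTrunc_two_mul s M).symm

theorem two_mul_eulerSum_bar_two_add : 2 * eulerSum [bar 2] + eulerSum [pl 2] = 0 := by
  linear_combination (1 / 2) * eulerSum_distribution le_rfl

theorem abs_eulerTrunc_bar_one_sub_le (N : ℕ) :
    |eulerTrunc N [bar 1] - eulerSum [bar 1]| ≤ eulerTerm (pl 1) (N + 1) := by
  set f : ℕ → ℝ := fun n => eulerTerm (pl 1) (n + 1)
  have hf : Antitone f := fun m n hmn => by
    simp only [f, eulerTerm_pl, pow_one]
    gcongr
  have halt (n : ℕ) : ∑ i ∈ range n, (-1) ^ i * f i = -eulerTrunc n [bar 1] := by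
    simp only [eulerTrunc_singleton, ← sum_neg_distrib]
    refine sum_congr rfl fun i _ => ?_
    simp [f, eulerTerm, pow_succ, neg_div, ← div_eq_mul_inv]
  have hlim : Tendsto (fun n => ∑ i ∈ range n, (-1) ^ i * f i) atTop (𝓝 (-eulerSum [bar 1])) := by
    simpa only [halt] using (admissible_bar_cons (l := []) (by simp)).tendsto.neg
  have hpos : 0 ≤ f N := by
    simp only [f, eulerTerm_pl]
    positivity
  rw [abs_le]
  obtain ⟨k, rfl | rfl⟩ := N.even_or_odd'
  · have hlower := hf.alternating_series_le_tendsto hlim k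
    have hupper := hf.tendsto_le_alternating_series hlim k
    rw [sum_range_succ, halt, (even_two_mul k).neg_one_pow, one_mul] at hupper
    rw [halt] at hlower
    constructor <;> linarith
  · have hlower := hf.alternating_series_le_tendsto hlim (k + 1)
    have hupper := hf.tendsto_le_alternating_series hlim k
    rw [mul_add_one, sum_range_succ, halt, (odd_two_mul_add_one k).neg_one_pow] at hlower
    rw [halt] at hupper
    constructor <;> linarith

theorem eulerSum_bar_one_sq : eulerSum [bar 1] ^ 2 = 2 * eulerSum [bar 1, pl 1] := by
  have hbar : Admissible [bar 1] := admissible_bar_cons (by simp)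
  have hbar₁ : Admissible [bar 1, pl 1] := admissible_bar_cons (by simp)
  have hshuffle (N : ℕ) : 2 * eulerTrunc (N + 1) [bar 1, pl 1] -
      eulerTrunc (N + 1) [bar 1] * eulerSum [bar 1] = ∑ p ∈ antidiagonal N,
        eulerTerm (bar 1) (p.1 + 1) * (eulerTrunc p.2 [bar 1] - eulerSum [bar 1]) := by
    simp only [mul_sub, sum_sub_distrib, ← sum_mul]
    rw [sum_antidiagonal_eulerTerm_mul_eulerTrunc, sum_antidiagonal_eulerTerm_fst, neg_mul_neg,
      one_mul, two_mul]
  have hbound (N : ℕ) : ‖2 * eulerTrunc (N + 1) [bar 1, pl 1] -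
      eulerTrunc (N + 1) [bar 1] * eulerSum [bar 1]‖ ≤
        2 * (eulerTrunc (N + 1 + 1) [pl 1, pl 1] - eulerTrunc (N + 1) [pl 1, pl 1]) := by
    calc _ ≤ ∑ p ∈ antidiagonal N, eulerTerm (pl 1) (p.1 + 1) * eulerTerm (pl 1) (p.2 + 1) := by
          rw [hshuffle]
          refine norm_sum_le_of_le _ fun p _ => ?_
          rw [Real.norm_eq_abs, abs_mul, abs_eulerTerm, ← eulerTerm_pl]
          gcongr
          · rw [eulerTerm_pl]; positivity
          · exact abs_eulerTrunc_bar_one_sub_le p.2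
      _ = _ := by
          rw [sum_antidiagonal_eulerTerm_mul_eulerTerm, one_mul, eulerTrunc_succ_cons (N + 1)]
          ring
  have hgap : Tendsto (fun N => 2 * (eulerTrunc (N + 1) [pl 1, pl 1] - eulerTrunc N [pl 1, pl 1]))
      atTop (𝓝 0) := by
    simpa using (tendsto_eulerTrunc_succ_sub (l := [pl 1, pl 1]) (by simp)).const_mul 2
  have hsucc := tendsto_add_atTop_nat 1
  have hzero := squeeze_zero_norm hbound (hgap.comp hsucc)
  have hlim := (hbar₁.tendsto.const_mul 2).sub (hbar.tendsto.mul_const (eulerSum [bar 1]))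
  linear_combination tendsto_nhds_unique hzero (hlim.comp hsucc)

theorem eulerSum_bar_one_one_add :
    eulerSum [bar 1, pl 1] + eulerSum [bar 2] = eulerSum [bar 1, bar 1] := by
  have hbar : Admissible [bar 1] := admissible_bar_cons (by simp)
  have hstuffle := eulerSum_mul hbar hbar
  simp only [stuffle, List.map_cons, List.map_nil, List.cons_append, List.nil_append, Nat.reduceAdd,
    mul_neg, mul_one, neg_neg, List.sum_cons, List.sum_nil, add_zero] at hstuffle
  linear_combination (1 / 2) * (hstuffle - eulerSum_bar_one_sq + two_mul_eulerSum_bar_two_add)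

theorem mem_posPairs {n : ℕ} {p : ℕ × ℕ} : p ∈ posPairs n ↔ p.1 + p.2 = n ∧ 1 ≤ p.1 ∧ 1 ≤ p.2 := by
  rw [posPairs, mem_filter, HasAntidiagonal.mem_antidiagonal]

theorem posPairs_one : posPairs 1 = ∅ := by
  decide

theorem sum_posPairs_succ {A : Type*} [AddCommMonoid A] {n : ℕ} (hn : 1 ≤ n) (F : ℕ → ℕ → A) :
    ∑ p ∈ posPairs (n + 1), F p.1 p.2 = F 1 n + ∑ p ∈ posPairs n, F (p.1 + 1) p.2 := by
  obtain ⟨n, rfl⟩ := Nat.exists_eq_add_of_le' hn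
  simp only [posPairs, sum_filter, Nat.sum_antidiagonal_succ]
  simp

theorem sum_posPairs_pow_mul_sub {R : Type*} [CommRing R] (x y : R) {u : ℕ} (hu : 1 ≤ u) :
    (∑ p ∈ posPairs u, x ^ p.1 * y ^ p.2) * (x - y) = x ^ u * y - x * y ^ u := by
  induction u, hu using Nat.le_induction with
  | base => rw [posPairs_one, sum_empty]; ring
  | succ u hu ih =>
    rw [sum_posPairs_succ hu fun a c => x ^ a * y ^ c]
    simp only [pow_succ x, mul_right_comm _ x, ← sum_mul, pow_zero, one_mul]
    linear_combination x * ih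

theorem sum_posPairs_eulerTerm_mul_eulerTerm (x z : ℤˣ) {u m n : ℕ} (hu : 1 ≤ u) (hm : 1 ≤ m)
    (hmn : m < n) :
    ∑ p ∈ posPairs u, eulerTerm (p.1 + 1, x) n * eulerTerm (p.2, z) m =
      eulerTerm (u, z) m * (((x : ℤ) : ℝ) ^ n * (1 / ((n : ℝ) - m) - 1 / n)) -
        eulerTerm (u, x) n * (((z : ℤ) : ℝ) ^ m / ((n : ℝ) - m)) := by
  have hm0 : (m : ℝ) ≠ 0 := by positivity
  have hn0 : (n : ℝ) ≠ 0 := by exact_mod_cast (hm.trans_lt hmn).ne_zero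
  have hsub : (n : ℝ) - m ≠ 0 := sub_ne_zero.2 (by exact_mod_cast hmn.ne')
  have hgeom := sum_posPairs_pow_mul_sub (n : ℝ)⁻¹ (m : ℝ)⁻¹ hu
  have hfactor : ∑ p ∈ posPairs u, eulerTerm (p.1 + 1, x) n * eulerTerm (p.2, z) m =
      ((x : ℤ) : ℝ) ^ n * ((z : ℤ) : ℝ) ^ m * (n : ℝ)⁻¹ *
        ∑ p ∈ posPairs u, (n : ℝ)⁻¹ ^ p.1 * (m : ℝ)⁻¹ ^ p.2 := by
    rw [mul_sum]
    refine sum_congr rfl fun p _ => ?_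
    simp only [eulerTerm, div_eq_mul_inv, pow_succ, inv_pow, mul_inv]
    ring
  rw [hfactor, eq_div_of_mul_eq (sub_ne_zero.2 (by simpa using hmn.ne')) hgeom]
  simp only [eulerTerm, div_eq_mul_inv, ← inv_pow]
  generalize (n : ℝ)⁻¹ ^ u = a, (m : ℝ)⁻¹ ^ u = b
  have hinv : (n : ℝ)⁻¹ - (m : ℝ)⁻¹ = -(((n : ℝ) - m) / (n * m)) := by
    field_simp
    ring
  rw [hinv]
  field_simp
  ring

theorem sum_range_sum_range_sum_range_comm {A : Type*} [AddCommMonoid A] (f : ℕ → ℕ → ℕ → A)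
    (M : ℕ) :
    ∑ n ∈ range M, ∑ k ∈ range n, ∑ m ∈ range k, f n k m =
      ∑ m ∈ range M, ∑ n ∈ Ico (m + 1) M, ∑ k ∈ Ico (m + 1) n, f n k m := by
  simp only [range_eq_Ico, ← sum_Ico_Ico_comm']

/-- What remains of the sum over `n > k > m` after fixing its smallest index `m`, with
`n = m + j + 1` and with the sum over `k` carried out. -/
noncomputable def innerSum (x y : ℤˣ) (m N : ℕ) : ℝ :=
  ∑ j ∈ range N, ((x : ℤ) : ℝ) ^ (m + j + 1) * (1 / ((j : ℝ) + 1) - 1 / ((m : ℝ) + j + 1)) *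
    (eulerTrunc (m + j) [(1, y)] - eulerTrunc m [(1, y)])

theorem sum_Ico_eulerTerm (a : SignedExp) {m n : ℕ} (h : m ≤ n) :
    ∑ k ∈ Ico m n, eulerTerm a (k + 1) = eulerTrunc n [a] - eulerTrunc m [a] := by
  rw [sum_Ico_eq_sub _ h, eulerTrunc_singleton, eulerTrunc_singleton]

theorem sum_sum_sum_kernel_eq_sum_innerSum (x y : ℤˣ) (a : ℕ → ℝ) (M : ℕ) :
    ∑ n ∈ range M, ∑ k ∈ range n, ∑ m ∈ range k, eulerTerm (1, y) (k + 1) *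
      (a m * (((x : ℤ) : ℝ) ^ (n + 1) * (1 / ((n : ℝ) - m) - 1 / ((n : ℝ) + 1)))) =
      ∑ m ∈ range M, a m * innerSum x y (m + 1) (M - (m + 1)) := by
  rw [sum_range_sum_range_sum_range_comm]
  refine sum_congr rfl fun m _ => ?_
  rw [sum_Ico_eq_sum_range, innerSum, mul_sum]
  refine sum_congr rfl fun j _ => ?_
  rw [← sum_mul, sum_Ico_eulerTerm _ (Nat.le_add_right _ _)]
  push_cast
  rw [show (m : ℝ) + 1 + j - m = j + 1 by ring]
  ring

theorem sum_posPairs_eulerTrunc (x y z : ℤˣ) {u : ℕ} (hu : 1 ≤ u) (M : ℕ) :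
    ∑ p ∈ posPairs u, eulerTrunc M [(p.1 + 1, x), (1, y), (p.2, z)] =
      ∑ m ∈ range M, eulerTerm (u, z) (m + 1) * innerSum x y (m + 1) (M - (m + 1)) -
        ∑ n ∈ range M, eulerTerm (u, x) (n + 1) * ∑ k ∈ range n, eulerTerm (1, y) (k + 1) *
          ∑ m ∈ range k, ((z : ℤ) : ℝ) ^ (m + 1) / ((n : ℝ) - m) := by
  rw [← sum_sum_sum_kernel_eq_sum_innerSum, ← sum_sub_distrib]
  simp only [eulerTrunc_cons, eulerTrunc_nil, mul_one]
  rw [sum_comm]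
  refine sum_congr rfl fun n _ => ?_
  simp only [mul_sum]
  rw [sum_comm, ← sum_sub_distrib]
  refine sum_congr rfl fun k hk => ?_
  rw [sum_comm, ← sum_sub_distrib]
  refine sum_congr rfl fun m hm => ?_
  have hmn : m + 1 < n + 1 := by
    have := mem_range.1 hk
    have := mem_range.1 hm
    lia
  have hkernel := sum_posPairs_eulerTerm_mul_eulerTerm x z hu le_add_self hmn
  push_cast [add_sub_add_right_eq_sub] at hkernel
  simp only [mul_left_comm _ (eulerTerm (1, y) (k + 1)), ← mul_sum, hkernel, mul_sub]

theorem sum_sign_pow_div_sub (z : ℤˣ) {k n : ℕ} (h : k ≤ n) :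
    ∑ m ∈ range k, ((z : ℤ) : ℝ) ^ (m + 1) / ((n : ℝ) - m) =
      ((z : ℤ) : ℝ) ^ (n + 1) * (eulerTrunc n [(1, z)] - eulerTrunc (n - k) [(1, z)]) := by
  induction k with
  | zero => simp
  | succ k ih =>
    obtain ⟨d, rfl⟩ := Nat.exists_eq_add_of_le h
    rw [sum_range_succ, ih (by lia), show k + 1 + d - k = d + 1 by lia,
      show k + 1 + d - (k + 1) = d by lia, eulerTrunc_succ_singleton, eulerTerm, pow_one,
      show k + 1 + d + 1 = (k + 1) + (d + 1) by ring, pow_add _ (k + 1) (d + 1)]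
    push_cast
    rw [show (k : ℝ) + 1 + d - k = d + 1 by ring]
    linear_combination (-((z : ℤ) : ℝ) ^ (k + 1) / (d + 1)) * sign_pow_mul_self z (d + 1)

theorem sum_eulerTerm_mul_sum_sign_pow_div_sub (y z : ℤˣ) (n : ℕ) :
    ∑ k ∈ range n, eulerTerm (1, y) (k + 1) *
        ∑ m ∈ range k, ((z : ℤ) : ℝ) ^ (m + 1) / ((n : ℝ) - m) =
      ((z : ℤ) : ℝ) ^ (n + 1) * (eulerTrunc n [(1, y)] * eulerTrunc n [(1, z)] -
        (eulerTrunc (n + 1) [(1, y), (1, y * z)] + eulerTrunc (n + 1) [(1, z), (1, y * z)])) := by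
  rw [← sum_antidiagonal_eulerTerm_mul_eulerTrunc, Nat.sum_antidiagonal_eq_sum_range_succ_mk,
    sum_range_succ, Nat.sub_self, eulerTrunc_zero, mul_zero, add_zero, eulerTrunc_singleton n,
    sum_mul, ← sum_sub_distrib, mul_sum]
  refine sum_congr rfl fun k hk => ?_
  rw [sum_sign_pow_div_sub z (mem_range.1 hk).le]
  ring

theorem sum_outer_eq (x y z : ℤˣ) (u M : ℕ) :
    ∑ n ∈ range M, eulerTerm (u, x) (n + 1) * ∑ k ∈ range n, eulerTerm (1, y) (k + 1) *
        ∑ m ∈ range k, ((z : ℤ) : ℝ) ^ (m + 1) / ((n : ℝ) - m) =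
      eulerTrunc M [(u, x * z), (1, y), (1, z)] + eulerTrunc M [(u, x * z), (1, z), (1, y)] +
        eulerTrunc M [(u, x * z), (2, y * z)] - eulerTrunc M [(u, x * z), (1, y), (1, y * z)] -
        eulerTrunc M [(u, x * z), (1, z), (1, y * z)] -
        eulerTrunc M [(u + 1, x * y * z), (1, y * z)] - eulerTrunc M [(u + 1, x), (1, y * z)] := by
  simp only [eulerTrunc_cons M, ← sum_add_distrib, ← sum_sub_distrib]
  refine sum_congr rfl fun n _ => ?_
  have hsign := sign_pow_mul_eulerTerm z x u (n + 1)
  have hy := eulerTerm_mul (u, x * z) (1, y) (n + 1)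
  have hz := eulerTerm_mul (u, x * z) (1, z) (n + 1)
  have hprod := eulerTrunc_mul [(1, y)] [(1, z)] n
  simp only [stuffle, List.map_cons, List.map_nil, List.cons_append, List.nil_append,
    List.sum_cons, List.sum_nil, add_zero, Nat.reduceAdd] at hprod
  rw [mul_comm z x] at hsign
  rw [mul_right_comm x z y] at hy
  rw [mul_assoc, ← pow_two, Int.units_sq, mul_one] at hz
  rw [sum_eulerTerm_mul_sum_sign_pow_div_sub, hprod, eulerTrunc_succ_cons n (1, y),
    eulerTrunc_succ_cons n (1, z), ← hy, ← hz, ← hsign]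
  ring

theorem sum_eulerTerm_add_mul_eulerTrunc (m N : ℕ) (a : SignedExp) (l : List SignedExp) :
    ∑ j ∈ range N, eulerTerm a (m + j + 1) * eulerTrunc (m + j) l =
      eulerTrunc (m + N) (a :: l) - eulerTrunc m (a :: l) := by
  rw [eulerTrunc_cons, eulerTrunc_cons, sum_range_add, add_sub_cancel_left]

theorem sum_eulerTerm_add (m N : ℕ) (a : SignedExp) :
    ∑ j ∈ range N, eulerTerm a (m + j + 1) = eulerTrunc (m + N) [a] - eulerTrunc m [a] := by
  simpa only [eulerTrunc_nil, mul_one] using sum_eulerTerm_add_mul_eulerTrunc m N a []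

theorem innerSum_eq (x y : ℤˣ) (m N : ℕ) :
    innerSum x y m N =
      ((x : ℤ) : ℝ) ^ m * ∑ i ∈ range m, ∑ j ∈ range N,
        eulerTerm (1, x) (j + 1) * eulerTerm (1, y) (i + j + 1) +
      ((x : ℤ) : ℝ) ^ m * (eulerTrunc N [(1, x), (1, y)] -
        ((x : ℤ) : ℝ) ^ m * eulerTrunc (m + N) [(1, x), (1, y)]) -
      eulerTrunc m [(1, y)] * (((x : ℤ) : ℝ) ^ m * (eulerTrunc N [(1, x)] -
        ((x : ℤ) : ℝ) ^ m * eulerTrunc (m + N) [(1, x)])) +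
      (eulerTrunc m [(1, x), (1, y)] - eulerTrunc m [(1, y)] * eulerTrunc m [(1, x)]) := by
  have hkernel (j : ℕ) : ((x : ℤ) : ℝ) ^ (m + j + 1) * (1 / ((j : ℝ) + 1) - 1 / ((m : ℝ) + j + 1)) =
      ((x : ℤ) : ℝ) ^ m * eulerTerm (1, x) (j + 1) - eulerTerm (1, x) (m + j + 1) := by
    simp only [eulerTerm, pow_one, Nat.cast_add, Nat.cast_one, add_assoc, pow_add _ m]
    ring
  have hgap (j : ℕ) : eulerTrunc (m + j) [(1, y)] =
      eulerTrunc j [(1, y)] + ∑ i ∈ range m, eulerTerm (1, y) (i + j + 1) := by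
    simp only [add_comm _ j, sum_eulerTerm_add, add_sub_cancel]
  have hshifted := sum_eulerTerm_add_mul_eulerTrunc m N (1, x) [(1, y)]
  have hshifted₀ := sum_eulerTerm_add m N (1, x)
  have hnear : ∑ j ∈ range N, eulerTerm (1, x) (j + 1) * eulerTrunc (m + j) [(1, y)] =
      eulerTrunc N [(1, x), (1, y)] + ∑ i ∈ range m, ∑ j ∈ range N,
        eulerTerm (1, x) (j + 1) * eulerTerm (1, y) (i + j + 1) := by
    rw [sum_comm, eulerTrunc_cons, ← sum_add_distrib]
    simp only [hgap, mul_add, mul_sum]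
  have hsign := sign_pow_mul_self x m
  calc innerSum x y m N = ((x : ℤ) : ℝ) ^ m * (∑ j ∈ range N,
          eulerTerm (1, x) (j + 1) * eulerTrunc (m + j) [(1, y)]) -
        ((x : ℤ) : ℝ) ^ m * (∑ j ∈ range N, eulerTerm (1, x) (j + 1)) * eulerTrunc m [(1, y)] -
        (∑ j ∈ range N, eulerTerm (1, x) (m + j + 1) * eulerTrunc (m + j) [(1, y)]) +
        (∑ j ∈ range N, eulerTerm (1, x) (m + j + 1)) * eulerTrunc m [(1, y)] := by
        simp only [innerSum, hkernel, mul_sum, sum_mul, ← sum_sub_distrib, ← sum_add_distrib]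
        exact sum_congr rfl fun j _ => by ring
    _ = _ := by
        rw [hnear, hshifted, hshifted₀, ← eulerTrunc_singleton]
        linear_combination (eulerTrunc (m + N) [(1, x), (1, y)] -
          eulerTrunc m [(1, y)] * eulerTrunc (m + N) [(1, x)]) * hsign

theorem tendsto_eulerTrunc_sub_sign_pow_mul (x : ℤˣ) {l : List SignedExp} (hl : ∀ a ∈ l, 1 ≤ a.1)
    (m : ℕ) :
    Tendsto (fun N => eulerTrunc N ((1, x) :: l) -
        ((x : ℤ) : ℝ) ^ m * eulerTrunc (m + N) ((1, x) :: l)) atTop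
      (𝓝 ((1 - ((x : ℤ) : ℝ) ^ m) * eulerSum (bar 1 :: l))) := by
  obtain rfl | rfl := Int.units_eq_one_or x
  · have hgap := tendsto_eulerTrunc_add_sub (l := pl 1 :: l) (List.forall_mem_cons.2 ⟨le_rfl, hl⟩) m
    simpa using hgap.neg
  · have hlim := (admissible_bar_cons hl).tendsto
    have hshift : Tendsto (fun N => m + N) atTop atTop := by
      simpa only [add_comm m] using tendsto_add_atTop_nat m
    rw [sub_mul, one_mul]
    exact hlim.sub ((hlim.comp hshift).const_mul _)

theorem sum_eulerTerm_mul_eulerTerm_add (x y : ℤˣ) {i : ℕ} (hi : 1 ≤ i) (N : ℕ) :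
    ∑ j ∈ range N, eulerTerm (1, x) (j + 1) * eulerTerm (1, y) (i + j + 1) =
      eulerTerm (1, y) i * (eulerTrunc N [(1, x * y)] -
        (((x * y : ℤˣ) : ℤ) : ℝ) ^ i * eulerTrunc (i + N) [(1, x * y)]) +
        eulerTerm (1, x) i * eulerTrunc i [(1, x * y)] := by
  have partialFractions (j : ℕ) :
      eulerTerm (1, x) (j + 1) * eulerTerm (1, y) (i + j + 1) =
        eulerTerm (1, y) i * (eulerTerm (1, x * y) (j + 1) -
          (((x * y : ℤˣ) : ℤ) : ℝ) ^ i * eulerTerm (1, x * y) (i + j + 1)) := by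
    have hsign := sign_pow_mul_self (x * y) i
    have hinv : ((j : ℝ) + 1)⁻¹ * ((i : ℝ) + j + 1)⁻¹ =
        (i : ℝ)⁻¹ * (((j : ℝ) + 1)⁻¹ - ((i : ℝ) + j + 1)⁻¹) := by
      have : (i : ℝ) ≠ 0 := by positivity
      have : (i : ℝ) + j + 1 ≠ 0 := by positivity
      field_simp
      ring
    simp only [eulerTerm, div_eq_mul_inv, pow_one, add_assoc i, pow_add _ i (j + 1)]
    push_cast [mul_pow] at hsign ⊢
    rw [← add_assoc]
    linear_combination ((x : ℤ) : ℝ) ^ (j + 1) * ((y : ℤ) : ℝ) ^ i * ((y : ℤ) : ℝ) ^ (j + 1) *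
      (hinv + (i : ℝ)⁻¹ * ((i : ℝ) + j + 1)⁻¹ * hsign)
  simp only [partialFractions, ← mul_sum, sum_sub_distrib, sum_eulerTerm_add,
    ← eulerTrunc_singleton]
  linear_combination eulerTrunc i [(1, x * y)] * mul_sign_pow_mul_eulerTerm x y 1 i

theorem tendsto_sum_eulerTerm_mul_eulerTerm_add (x y : ℤˣ) (m : ℕ) :
    Tendsto (fun N => ∑ i ∈ range (m + 1), ∑ j ∈ range N,
        eulerTerm (1, x) (j + 1) * eulerTerm (1, y) (i + j + 1)) atTop
      (𝓝 (eulerSum [(2, x * y)] +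
        eulerSum [bar 1] * (eulerTrunc m [(1, y)] - eulerTrunc m [(1, x)]) +
        eulerTrunc m [(1, x), (1, x * y)] + eulerTrunc m [(2, y)])) := by
  have hdiag : Tendsto
      (fun N => ∑ j ∈ range N, eulerTerm (1, x) (j + 1) * eulerTerm (1, y) (0 + j + 1)) atTop
      (𝓝 (eulerSum [(2, x * y)])) := by
    have hlim := (admissible_cons (l := []) le_rfl (x * y) (by simp)).tendsto
    simpa only [zero_add, eulerTerm_mul, eulerTrunc_singleton] using hlim
  induction m with
  | zero => simpa [eulerTrunc_zero] using hdiag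
  | succ m ih =>
    have hshift := tendsto_eulerTrunc_sub_sign_pow_mul (x * y) (l := []) (by simp) (m + 1)
    have hterm := (hshift.const_mul (eulerTerm (1, y) (m + 1))).add_const
      (eulerTerm (1, x) (m + 1) * eulerTrunc (m + 1) [(1, x * y)])
    have hy : eulerTerm (1, x) (m + 1) * eulerTerm (1, x * y) (m + 1) =
        eulerTerm (2, y) (m + 1) := by
      simpa only [← mul_assoc, Int.units_mul_self, one_mul, Nat.reduceAdd] using
        eulerTerm_mul (1, x) (1, x * y) (m + 1)
    simp only [← sum_eulerTerm_mul_eulerTerm_add x y (Nat.le_add_left 1 m)] at hterm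
    simp only [sum_range_succ _ (m + 1)]
    convert ih.add hterm using 2
    simp only [eulerTrunc_succ_cons m, eulerTrunc_nil]
    linear_combination eulerSum [bar 1] * mul_sign_pow_mul_eulerTerm x y 1 (m + 1) - hy

/-- The limit of `innerSum x y (m + 1) N` as `N → ∞`, in terms of truncated sums of bound `m`. -/
noncomputable def innerLimit (x y : ℤˣ) (m : ℕ) : ℝ :=
  ((x : ℤ) : ℝ) ^ (m + 1) * eulerSum [(2, x * y)] +
    (((x : ℤ) : ℝ) ^ (m + 1) - 1) * eulerSum [bar 1, (1, y)] +
    eulerSum [bar 1] * (eulerTrunc m [(1, y)] - ((x : ℤ) : ℝ) ^ (m + 1) * eulerTrunc m [(1, x)] -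
      (((x : ℤ) : ℝ) ^ (m + 1) - 1) * eulerTerm (1, y) (m + 1)) +
    ((x : ℤ) : ℝ) ^ (m + 1) * (eulerTrunc m [(1, x), (1, x * y)] + eulerTrunc m [(2, y)]) -
    eulerTrunc m [(1, y), (1, x)] - eulerTerm (1, y) (m + 1) * eulerTrunc m [(1, x)] -
    eulerTrunc m [(2, x * y)] - eulerTerm (2, x * y) (m + 1)

theorem tendsto_innerSum (x y : ℤˣ) (m : ℕ) :
    Tendsto (innerSum x y (m + 1)) atTop (𝓝 (innerLimit x y m)) := by
  have hsquare := tendsto_sum_eulerTerm_mul_eulerTerm_add x y m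
  have hpair := tendsto_eulerTrunc_sub_sign_pow_mul x (l := [(1, y)]) (by simp) (m + 1)
  have hsingle := tendsto_eulerTrunc_sub_sign_pow_mul x (l := []) (by simp) (m + 1)
  let σ := ((x : ℤ) : ℝ) ^ (m + 1)
  have hσ : σ * σ = 1 := sign_pow_mul_self x (m + 1)
  have hlim := ((((hsquare.const_mul σ).add (hpair.const_mul σ)).sub
    ((hsingle.const_mul σ).const_mul (eulerTrunc (m + 1) [(1, y)]))).add_const
    (eulerTrunc (m + 1) [(1, x), (1, y)] -
      eulerTrunc (m + 1) [(1, y)] * eulerTrunc (m + 1) [(1, x)]))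
  have hprod := eulerTrunc_mul [(1, y)] [(1, x)] m
  have hterm := eulerTerm_mul (1, x) (1, y) (m + 1)
  simp only [stuffle, List.map_cons, List.map_nil, List.cons_append, List.nil_append,
    List.sum_cons, List.sum_nil, add_zero, Nat.reduceAdd, mul_comm y x] at hprod hterm
  convert hlim using 2
  · rw [innerSum_eq]
  · simp only [innerLimit, eulerTrunc_succ_cons m, eulerTrunc_nil]
    linear_combination hprod + hterm + (eulerSum [bar 1, (1, y)] -
      eulerSum [bar 1] * (eulerTrunc m [(1, y)] + eulerTerm (1, y) (m + 1))) * hσ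

theorem summable_harmonic_pow_div_rpow (d : ℕ) {s : ℝ} (hs : 1 < s) :
    Summable fun n : ℕ => (harmonic (n + 1) : ℝ) ^ d / ((n : ℝ) + 1) ^ s := by
  have hmid : 1 < (1 + s) / 2 := by linarith
  have hgap : 0 < (s - 1) / 2 := by linarith
  have hbase : Summable fun n : ℕ => 1 / ((n : ℝ) + 1) ^ ((1 + s) / 2) := by
    simpa using (summable_nat_add_iff 1).2 (Real.summable_one_div_nat_rpow.2 hmid)
  have hO := (harmonic_pow_isLittleO d _ hgap).isBigO.mul
    (Asymptotics.isBigO_refl (fun n : ℕ => (((n : ℝ) + 1) ^ s)⁻¹) atTop)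
  refine summable_of_isBigO_nat hbase ((hO.congr_right fun n => ?_).congr_left fun n => ?_)
  · have hn : (0 : ℝ) < (n : ℝ) + 1 := by positivity
    rw [one_div, ← Real.rpow_neg hn.le, ← Real.rpow_neg hn.le, ← Real.rpow_add hn]
    ring_nf
  · rw [div_eq_mul_inv]

theorem one_div_sub_one_div_add_le {a b : ℝ} (ha : 0 < a) (hb : 0 < b) :
    1 / b - 1 / (a + b) ≤ a ^ (1 / 2 : ℝ) / b ^ (3 / 2 : ℝ) := by
  have hdiff : 1 / b - 1 / (a + b) = a / (a + b) / b := by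
    field_simp
    ring
  have hmean : a ^ (1 / 2 : ℝ) * b ^ (1 / 2 : ℝ) ≤ a + b := by
    rw [← Real.sqrt_eq_rpow, ← Real.sqrt_eq_rpow]
    nlinarith [Real.sq_sqrt ha.le, Real.sq_sqrt hb.le, sq_nonneg (√a - √b)]
  have hsplit : a ^ (1 / 2 : ℝ) * a ^ (1 / 2 : ℝ) = a := by
    rw [← Real.rpow_add ha, add_halves, Real.rpow_one]
  have hpow : b ^ (3 / 2 : ℝ) = b ^ (1 / 2 : ℝ) * b := by
    rw [← Real.rpow_add_one hb.ne']
    norm_num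
  rw [hdiff, hpow, ← div_div]
  refine div_le_div_of_nonneg_right ?_ hb.le
  rw [div_le_div_iff₀ (by positivity) (by positivity)]
  calc a * b ^ (1 / 2 : ℝ) = a ^ (1 / 2 : ℝ) * (a ^ (1 / 2 : ℝ) * b ^ (1 / 2 : ℝ)) := by
        rw [← mul_assoc, hsplit]
    _ ≤ _ := by gcongr

theorem abs_eulerTrunc_add_sub_le (y : ℤˣ) (m j : ℕ) :
    |eulerTrunc (m + j) [(1, y)] - eulerTrunc m [(1, y)]| ≤ (harmonic (j + 1) : ℝ) := by
  rw [← sum_eulerTerm_add, harmonic]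
  push_cast
  refine (abs_sum_le_sum_abs _ _).trans ((sum_le_sum fun i _ => ?_).trans
    (sum_le_sum_of_subset_of_nonneg (range_mono j.le_succ) fun i _ _ => by positivity))
  rw [abs_eulerTerm, pow_one, one_div]
  push_cast
  gcongr
  exact le_add_of_nonneg_left (by positivity)

theorem abs_innerSum_le (x y : ℤˣ) {m : ℕ} (hm : 1 ≤ m) (N : ℕ) :
    |innerSum x y m N| ≤ (m : ℝ) ^ (1 / 2 : ℝ) *
      ∑' j : ℕ, (harmonic (j + 1) : ℝ) ^ 1 / ((j : ℝ) + 1) ^ (3 / 2 : ℝ) := by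
  have hsum := summable_harmonic_pow_div_rpow 1 (s := 3 / 2) (by norm_num)
  have hnonneg (j : ℕ) : 0 ≤ (harmonic (j + 1) : ℝ) ^ 1 / ((j : ℝ) + 1) ^ (3 / 2 : ℝ) := by
    have := harmonic_cast_nonneg (j + 1)
    positivity
  have hm0 : (0 : ℝ) < m := by exact_mod_cast hm
  calc |innerSum x y m N| ≤ ∑ j ∈ range N, (m : ℝ) ^ (1 / 2 : ℝ) *
        ((harmonic (j + 1) : ℝ) ^ 1 / ((j : ℝ) + 1) ^ (3 / 2 : ℝ)) := by
        refine (abs_sum_le_sum_abs _ _).trans (sum_le_sum fun j _ => ?_)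
        have hkernel := one_div_sub_one_div_add_le hm0 (b := (j : ℝ) + 1) (by positivity)
        have hkernel0 : (0 : ℝ) ≤ 1 / ((j : ℝ) + 1) - 1 / ((m : ℝ) + j + 1) := by
          rw [sub_nonneg]
          gcongr
          linarith
        rw [abs_mul, abs_mul, abs_sign_pow, one_mul, abs_of_nonneg hkernel0, pow_one,
          mul_div_left_comm, mul_comm (harmonic (j + 1) : ℝ)]
        rw [← add_assoc] at hkernel
        exact mul_le_mul hkernel (abs_eulerTrunc_add_sub_le y m j) (abs_nonneg _)
          (hkernel0.trans hkernel)
    _ ≤ _ := by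
        rw [← mul_sum]
        gcongr
        exact hsum.sum_le_tsum _ fun j _ => hnonneg j

theorem tendsto_sum_range_of_dominated {F : ℕ → ℕ → ℝ} {E b : ℕ → ℝ} {x : ℝ} (hb : Summable b)
    (hF : ∀ M m, |F M m| ≤ b m) (hlim : ∀ m, Tendsto (F · m) atTop (𝓝 (E m)))
    (hE : Tendsto (fun M => ∑ m ∈ range M, E m) atTop (𝓝 x)) :
    Tendsto (fun M => ∑ m ∈ range M, F M m) atTop (𝓝 x) := by
  have hEb (m : ℕ) : ‖E m‖ ≤ b m := le_of_tendsto (hlim m).norm (.of_forall fun M => hF M m)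
  have hsum : ∑' m, E m = x :=
    tendsto_nhds_unique (Summable.of_norm_bounded hb hEb).hasSum.tendsto_sum_nat hE
  have hdom := tendsto_tsum_of_dominated_convergence (𝓕 := atTop)
    (f := fun M m => if m ∈ range M then F M m else 0) (g := E) hb
    (fun m => (hlim m).congr' ?_) (.of_forall fun M m => ?_)
  · rw [hsum] at hdom
    refine hdom.congr fun M => ?_
    rw [tsum_eq_sum (s := range M) fun m hm => if_neg hm]
    exact sum_congr rfl fun m hm => if_pos hm
  · filter_upwards [eventually_gt_atTop m] with M hM
    exact (if_pos (mem_range.2 hM)).symm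
  · split_ifs
    · exact hF M m
    · exact norm_zero.trans_le ((norm_nonneg _).trans (hEb m))

theorem sum_eulerTerm_mul_innerLimit (x y z : ℤˣ) (u M : ℕ) :
    ∑ m ∈ range M, eulerTerm (u, z) (m + 1) * innerLimit x y m =
      eulerSum [(2, x * y)] * eulerTrunc M [(u, x * z)] +
        eulerSum [bar 1, (1, y)] * (eulerTrunc M [(u, x * z)] - eulerTrunc M [(u, z)]) +
        eulerSum [bar 1] * (eulerTrunc M [(u, z), (1, y)] - eulerTrunc M [(u, x * z), (1, x)] -
          (eulerTrunc M [(u + 1, x * y * z)] - eulerTrunc M [(u + 1, y * z)])) +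
        (eulerTrunc M [(u, x * z), (1, x), (1, x * y)] + eulerTrunc M [(u, x * z), (2, y)]) -
        eulerTrunc M [(u, z), (1, y), (1, x)] - eulerTrunc M [(u + 1, y * z), (1, x)] -
        eulerTrunc M [(u, z), (2, x * y)] - eulerTrunc M [(u + 2, x * y * z)] := by
  simp only [eulerTrunc_cons M, eulerTrunc_nil, mul_one, ← sum_add_distrib, ← sum_sub_distrib,
    mul_sum, innerLimit]
  refine sum_congr rfl fun m _ => ?_
  have hxz := sign_pow_mul_eulerTerm x z u (m + 1)
  have hxyz := sign_pow_mul_eulerTerm x (y * z) (u + 1) (m + 1)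
  have hy := eulerTerm_mul (u, z) (1, y) (m + 1)
  have hxy := eulerTerm_mul (u, z) (2, x * y) (m + 1)
  rw [mul_comm z y] at hy
  rw [mul_comm z] at hxy
  rw [← mul_assoc x y z, ← hy] at hxyz
  rw [← hxz, ← hxyz, ← hy, ← hxy]
  ring

theorem tendsto_sum_eulerTerm_mul_innerSum (x y z : ℤˣ) {u : ℕ} (hu : 2 ≤ u) {a : ℝ}
    (ha : Tendsto (fun M => ∑ m ∈ range M, eulerTerm (u, z) (m + 1) * innerLimit x y m) atTop
      (𝓝 a)) :
    Tendsto (fun M => ∑ m ∈ range M, eulerTerm (u, z) (m + 1) *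
      innerSum x y (m + 1) (M - (m + 1))) atTop (𝓝 a) := by
  have hweight : Summable fun m : ℕ => ((m : ℝ) + 1) ^ (1 / 2 : ℝ) / ((m : ℝ) + 1) ^ 2 := by
    refine (summable_harmonic_pow_div_rpow 0 (s := 3 / 2) (by norm_num)).congr fun m => ?_
    have hm : (0 : ℝ) < (m : ℝ) + 1 := by positivity
    rw [pow_zero, one_div, ← Real.rpow_neg hm.le, ← Real.rpow_natCast, ← Real.rpow_sub hm]
    norm_num
  refine tendsto_sum_range_of_dominated (hweight.mul_right (∑' j : ℕ,
    (harmonic (j + 1) : ℝ) ^ 1 / ((j : ℝ) + 1) ^ (3 / 2 : ℝ))) (fun M m => ?_) (fun m =>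
    ((tendsto_innerSum x y m).comp (tendsto_sub_atTop_nat (m + 1))).const_mul _) ha
  have hle := abs_innerSum_le x y (Nat.le_add_left 1 m) (M - (m + 1))
  have hone : (1 : ℝ) ≤ (m : ℝ) + 1 := le_add_of_nonneg_left m.cast_nonneg
  rw [abs_mul, abs_eulerTerm, div_mul_eq_mul_div, one_mul, div_mul_eq_mul_div]
  push_cast at hle ⊢
  gcongr
  exact (abs_nonneg _).trans hle

theorem sum_posPairs_eulerSum (x y z : ℤˣ) {u : ℕ} (hu : 2 ≤ u) :
    ∑ p ∈ posPairs u, eulerSum [(p.1 + 1, x), (1, y), (p.2, z)] =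
      eulerSum [(2, x * y)] * eulerSum [(u, x * z)] +
        eulerSum [bar 1, (1, y)] * (eulerSum [(u, x * z)] - eulerSum [(u, z)]) +
        eulerSum [bar 1] * (eulerSum [(u, z), (1, y)] - eulerSum [(u, x * z), (1, x)] -
          (eulerSum [(u + 1, x * y * z)] - eulerSum [(u + 1, y * z)])) +
        (eulerSum [(u, x * z), (1, x), (1, x * y)] + eulerSum [(u, x * z), (2, y)]) -
        eulerSum [(u, z), (1, y), (1, x)] - eulerSum [(u + 1, y * z), (1, x)] -
        eulerSum [(u, z), (2, x * y)] - eulerSum [(u + 2, x * y * z)] -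
      (eulerSum [(u, x * z), (1, y), (1, z)] + eulerSum [(u, x * z), (1, z), (1, y)] +
        eulerSum [(u, x * z), (2, y * z)] - eulerSum [(u, x * z), (1, y), (1, y * z)] -
        eulerSum [(u, x * z), (1, z), (1, y * z)] -
        eulerSum [(u + 1, x * y * z), (1, y * z)] - eulerSum [(u + 1, x), (1, y * z)]) := by
  have hlim {s : ℕ} (hs : 2 ≤ s) (σ : ℤˣ) {l : List SignedExp} (hl : ∀ a ∈ l, 1 ≤ a.1) :=
    (admissible_cons hs σ hl).tendsto
  have hsplit := sum_posPairs_eulerTrunc x y z (one_le_two.trans hu)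
  simp only [sum_outer_eq] at hsplit
  refine tendsto_nhds_unique (tendsto_finsetSum _ fun p hp => ?_)
    (.congr (fun M => (hsplit M).symm) (.sub (tendsto_sum_eulerTerm_mul_innerSum x y z hu ?_) ?_))
  · obtain ⟨-, hp₁, hp₂⟩ := mem_posPairs.1 hp
    exact hlim (Nat.succ_le_succ hp₁) x (by simpa using hp₂)
  · simp only [sum_eulerTerm_mul_innerLimit]
    repeat' first | apply hlim | apply Tendsto.sub | apply Tendsto.add | apply Tendsto.const_mul
    all_goals first | lia | simp
  · repeat' first | apply hlim | apply Tendsto.sub | apply Tendsto.add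
    all_goals first | lia | simp

theorem eulerSum_singleton_mul_singleton {a b : SignedExp} (ha : Admissible [a])
    (hb : Admissible [b]) :
    eulerSum [a] * eulerSum [b] =
      eulerSum [a, b] + eulerSum [b, a] + eulerSum [(a.1 + b.1, a.2 * b.2)] := by
  rw [eulerSum_mul ha hb]
  simp only [stuffle, List.map_cons, List.map_nil, List.cons_append, List.nil_append,
    List.sum_cons, List.sum_nil, add_zero, add_assoc]

theorem eulerSum_singleton_mul_pair {a b c : SignedExp} (ha : Admissible [a])
    (hbc : Admissible [b, c]) :
    eulerSum [a] * eulerSum [b, c] =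
      eulerSum [a, b, c] + eulerSum [b, a, c] + eulerSum [b, c, a] +
        eulerSum [b, (a.1 + c.1, a.2 * c.2)] + eulerSum [(a.1 + b.1, a.2 * b.2), c] := by
  rw [eulerSum_mul ha hbc]
  simp only [stuffle, List.map_cons, List.map_nil, List.cons_append, List.nil_append,
    List.sum_cons, List.sum_nil, add_zero, add_assoc]

section DepthReduction

variable {u : ℕ} (hu : 2 ≤ u)
include hu

theorem eulerSum_two_mul_singleton (y z : ℤˣ) :
    eulerSum [(2, y)] * eulerSum [(u, z)] =
      eulerSum [(2, y), (u, z)] + eulerSum [(u, z), (2, y)] + eulerSum [(u + 2, y * z)] := by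
  rw [eulerSum_singleton_mul_singleton (admissible_cons le_rfl y (by simp))
    (admissible_cons hu z (by simp)), add_comm u]

theorem eulerSum_bar_one_mul_singleton (z : ℤˣ) :
    eulerSum [bar 1] * eulerSum [(u, z)] =
      eulerSum [bar 1, (u, z)] + eulerSum [(u, z), bar 1] + eulerSum [(u + 1, -z)] := by
  rw [eulerSum_singleton_mul_singleton (admissible_bar_cons (by simp))
    (admissible_cons hu z (by simp)), add_comm u, neg_one_mul]

theorem eulerSum_bar_one_mul_pair (y z : ℤˣ) :
    eulerSum [bar 1] * eulerSum [(u, y), (1, z)] =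
      eulerSum [bar 1, (u, y), (1, z)] + eulerSum [(u, y), bar 1, (1, z)] +
        eulerSum [(u, y), (1, z), bar 1] + eulerSum [(u, y), (2, -z)] +
        eulerSum [(u + 1, -y), (1, z)] := by
  rw [eulerSum_singleton_mul_pair (admissible_bar_cons (by simp))
    (admissible_cons hu y (by simp))]
  simp only [add_comm 1 u, neg_one_mul, Nat.reduceAdd]

theorem eulerSum_singleton_mul_bar_one_pair (y z : ℤˣ) :
    eulerSum [(u, y)] * eulerSum [bar 1, (1, z)] =
      eulerSum [(u, y), bar 1, (1, z)] + eulerSum [bar 1, (u, y), (1, z)] +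
        eulerSum [bar 1, (1, z), (u, y)] + eulerSum [bar 1, (u + 1, y * z)] +
        eulerSum [(u + 1, -y), (1, z)] := by
  rw [eulerSum_singleton_mul_pair (admissible_cons hu y (by simp))
    (admissible_bar_cons (by simp)), mul_neg_one]

theorem sum_posPairs_eulerSum_bar (y z : ℤˣ) :
    ∑ p ∈ posPairs (u + 1), eulerSum [bar p.1, (1, y), (p.2, z)] =
      eulerSum [bar 1, (1, y), (u, z)] +
        ∑ p ∈ posPairs u, eulerSum [bar (p.1 + 1), (1, y), (p.2, z)] :=
  sum_posPairs_succ (one_le_two.trans hu) fun a c => eulerSum [bar a, (1, y), (c, z)]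

theorem sum_eulerSum_pl_pl_pl :
    ∑ p ∈ posPairs u, eulerSum [pl (p.1 + 1), pl 1, pl p.2] =
      eulerSum [pl (u + 1), pl 1] + eulerSum [pl 2, pl u] := by
  have hsum := sum_posPairs_eulerSum 1 1 1 hu
  simp only [mul_one] at hsum
  have hprod := eulerSum_two_mul_singleton hu 1 1
  simp only [mul_one] at hprod
  linear_combination hsum + hprod

theorem sum_eulerSum_pl_bar_bar :
    ∑ p ∈ posPairs u, eulerSum [pl (p.1 + 1), bar 1, bar p.2] =
      eulerSum [bar 1, bar u, bar 1] - eulerSum [bar 1, bar u, pl 1] +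
        eulerSum [pl (u + 1), bar 1] + eulerSum [bar 2, bar u] := by
  have hsum := sum_posPairs_eulerSum 1 (-1) (-1) hu
  have h₁ := eulerSum_two_mul_singleton hu (-1) (-1)
  have h₂ := eulerSum_bar_one_mul_pair hu (-1) (-1)
  have h₃ := eulerSum_bar_one_mul_pair hu (-1) 1
  simp only [mul_neg, mul_one, neg_neg] at hsum h₁ h₂ h₃
  linear_combination hsum + h₁ + h₂ - h₃

theorem sum_eulerSum_bar_bar_pl :
    ∑ p ∈ posPairs (u + 1), eulerSum [bar p.1, bar 1, pl p.2] =
      eulerSum [bar 1, bar 1, bar u] + eulerSum [pl 2, bar u] + eulerSum [bar (u + 1), bar 1] := by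
  have hsum := sum_posPairs_eulerSum (-1) (-1) 1 hu
  have h₁ := eulerSum_two_mul_singleton hu 1 (-1)
  have h₂ := eulerSum_bar_one_mul_singleton (u := u + 1) (by lia) 1
  have h₃ := eulerSum_bar_one_mul_pair hu (-1) (-1)
  have h₄ := eulerSum_singleton_mul_bar_one_pair hu (-1) (-1)
  have h₅ := eulerSum_bar_one_mul_pair hu 1 (-1)
  have h₆ := eulerSum_singleton_mul_bar_one_pair hu 1 (-1)
  have h₇ := eulerSum_bar_one_mul_singleton (u := u + 1) (by lia) (-1)
  rw [sum_posPairs_eulerSum_bar hu]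
  simp only [mul_neg, mul_one, neg_neg] at hsum h₁ h₂ h₃ h₄ h₅ h₆ h₇
  linear_combination hsum + h₄ - h₃ + h₁ - h₂ + h₅ - h₆ + h₇

theorem sum_eulerSum_bar_pl_bar :
    ∑ p ∈ posPairs (u + 1), eulerSum [bar p.1, pl 1, bar p.2] =
      eulerSum [bar 1, pl u, pl 1] + eulerSum [bar 1, pl 1, pl u] -
        eulerSum [bar 1, pl u, bar 1] + eulerSum [bar (u + 1), pl 1] + eulerSum [bar 2, pl u] := by
  have hsum := sum_posPairs_eulerSum (-1) 1 (-1) hu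
  have h₁ := eulerSum_two_mul_singleton hu (-1) 1
  have h₂ := eulerSum_bar_one_mul_singleton (u := u + 1) (by lia) 1
  have h₃ := eulerSum_bar_one_mul_singleton (u := u + 1) (by lia) (-1)
  have h₄ := eulerSum_singleton_mul_bar_one_pair hu 1 1
  have h₅ := eulerSum_singleton_mul_bar_one_pair hu (-1) 1
  have h₆ := eulerSum_bar_one_mul_pair hu 1 (-1)
  have h₇ := eulerSum_bar_one_mul_pair hu (-1) 1
  rw [sum_posPairs_eulerSum_bar hu]
  simp only [mul_neg, mul_one, neg_neg] at hsum h₁ h₂ h₃ h₄ h₅ h₆ h₇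
  linear_combination hsum + h₄ + h₁ - h₂ - h₆ + h₇ - h₅ + h₃

theorem sum_eulerSum_bar_pl_pl :
    ∑ p ∈ posPairs (u + 1), eulerSum [bar p.1, pl 1, pl p.2] =
      eulerSum [bar 1, bar 1, bar u] + 2 * eulerSum [bar (u + 1), pl 1] +
        eulerSum [bar 1, pl (u + 1)] - eulerSum [bar 1, bar (u + 1)] -
        eulerSum [bar (u + 1), bar 1] - eulerSum [bar u, pl 2] - eulerSum [pl (u + 2)] := by
  have hsum := sum_posPairs_eulerSum (-1) 1 1 hu
  have h₁ := eulerSum_singleton_mul_bar_one_pair hu (-1) (-1)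
  have h₂ := eulerSum_bar_one_mul_pair hu (-1) (-1)
  have h₃ := eulerSum_bar_one_mul_singleton (u := u + 1) (by lia) (-1)
  have h₄ := eulerSum_bar_one_mul_pair hu 1 1
  have h₅ := eulerSum_singleton_mul_bar_one_pair hu 1 1
  have h₆ := eulerSum_bar_one_mul_singleton (u := u + 1) (by lia) 1
  rw [sum_posPairs_eulerSum_bar hu]
  simp only [mul_neg, mul_one, neg_neg] at hsum h₁ h₂ h₃ h₄ h₅ h₆
  linear_combination hsum + eulerSum [bar u] * eulerSum_bar_one_one_add + h₁ - h₂ - h₃ +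
    h₄ - h₅ + h₆

theorem sum_eulerSum_pl_pl_bar :
    ∑ p ∈ posPairs u, eulerSum [pl (p.1 + 1), pl 1, bar p.2] =
      eulerSum [bar u, bar 1, bar 1] - eulerSum [bar u, bar 1, pl 1] +
        eulerSum [pl (u + 1), bar 1] + eulerSum [bar (u + 1), bar 1] -
        eulerSum [bar (u + 1), pl 1] - eulerSum [bar u, bar 2] +
        eulerSum [pl 2] * eulerSum [bar u] - eulerSum [bar (u + 2)] := by
  have hsum := sum_posPairs_eulerSum 1 1 (-1) hu
  simp only [mul_neg, mul_one] at hsum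
  linear_combination hsum

theorem sum_eulerSum_pl_bar_pl :
    ∑ p ∈ posPairs u, eulerSum [pl (p.1 + 1), bar 1, pl p.2] =
      2 * eulerSum [pl u, bar 1, bar 1] - 2 * eulerSum [pl u, bar 1, pl 1] +
        eulerSum [bar 1, pl 1, pl u] - eulerSum [bar 1, bar 1, pl u] +
        eulerSum [bar (u + 1), bar 1] + eulerSum [pl (u + 1), bar 1] +
        eulerSum [bar 1, pl (u + 1)] - eulerSum [bar (u + 1), pl 1] -
        eulerSum [bar 1, bar (u + 1)] - eulerSum [pl 2, pl u] - 2 * eulerSum [pl u, bar 2] -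
        eulerSum [bar (u + 2)] - eulerSum [pl (u + 2)] := by
  have hsum := sum_posPairs_eulerSum 1 (-1) 1 hu
  have h₁ := eulerSum_two_mul_singleton hu 1 1
  have h₂ := eulerSum_bar_one_mul_pair hu 1 1
  have h₃ := eulerSum_bar_one_mul_pair hu 1 (-1)
  have h₄ := eulerSum_singleton_mul_bar_one_pair hu 1 1
  have h₅ := eulerSum_singleton_mul_bar_one_pair hu 1 (-1)
  simp only [mul_neg, mul_one, neg_neg] at hsum h₁ h₂ h₃ h₄ h₅
  linear_combination hsum + h₃ - h₂ + h₄ - h₅ - h₁ -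
    eulerSum [pl u] * (eulerSum_bar_one_one_add - two_mul_eulerSum_bar_two_add)

theorem sum_eulerSum_bar_bar_bar :
    ∑ p ∈ posPairs (u + 1), eulerSum [bar p.1, bar 1, bar p.2] =
      3 * eulerSum [pl u, bar 1, pl 1] - 3 * eulerSum [pl u, bar 1, bar 1] +
        eulerSum [bar 1, bar 1, pl u] + 2 * eulerSum [bar (u + 1), pl 1] -
        eulerSum [bar (u + 1), bar 1] + eulerSum [pl u, bar 2] + eulerSum [pl 2, pl u] -
        eulerSum [pl u, pl 2] := by
  have hsum := sum_posPairs_eulerSum (-1) (-1) (-1) hu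
  have h₁ := eulerSum_two_mul_singleton hu 1 1
  have h₂ := eulerSum_bar_one_mul_singleton (u := u + 1) (by lia) (-1)
  have h₃ := eulerSum_bar_one_mul_pair hu 1 (-1)
  have h₄ := eulerSum_singleton_mul_bar_one_pair hu 1 (-1)
  have h₅ := eulerSum_bar_one_mul_pair hu (-1) (-1)
  have h₆ := eulerSum_singleton_mul_bar_one_pair hu (-1) (-1)
  have h₇ := eulerSum_bar_one_mul_singleton (u := u + 1) (by lia) 1
  rw [sum_posPairs_eulerSum_bar hu]
  simp only [mul_neg, mul_one, neg_neg] at hsum h₁ h₂ h₃ h₄ h₅ h₆ h₇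
  linear_combination hsum + h₄ + h₁ - h₃ - h₂ + h₅ - h₆ + h₇

end DepthReduction

theorem regStar_cons_of_ne {a : SignedExp} (ha : a ≠ pl 1) (l : List SignedExp) :
    regStar (a :: l) = C (eulerSum (a :: l)) := by
  rw [regStar, dif_neg ha]

theorem sum_posPairs_regStar {u : ℕ} (hu : 1 ≤ u) (y z : ℤˣ) :
    ∑ p ∈ posPairs (u + 1), regStar [pl p.1, (1, y), (p.2, z)] =
      regStar [pl 1, (1, y), (u, z)] +
        C (∑ p ∈ posPairs u, eulerSum [pl (p.1 + 1), (1, y), (p.2, z)]) := by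
  rw [sum_posPairs_succ hu fun a c => regStar [pl a, (1, y), (c, z)], map_sum]
  congr 1
  refine sum_congr rfl fun p hp => regStar_cons_of_ne ?_ _
  obtain ⟨-, hp, -⟩ := mem_posPairs.1 hp
  simpa using Nat.pos_iff_ne_zero.1 hp

theorem mainTheorem12 (w u v : ℕ) (hw : 4 ≤ w) (hu : u = w - 2) (hv : v = w - 1) :
    (∑ p ∈ posPairs (w - 1), regStar [pl p.1, pl 1, pl p.2] =
      regStar [pl 1, pl 1, pl u] + C (eulerSum [pl v, pl 1]) + C (eulerSum [pl 2, pl u])) ∧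
    (∑ p ∈ posPairs (w - 1), regStar [pl p.1, bar 1, bar p.2] =
      regStar [pl 1, bar 1, bar u] + C (eulerSum [bar 1, bar u, bar 1])
        - C (eulerSum [bar 1, bar u, pl 1]) + C (eulerSum [pl v, bar 1])
        + C (eulerSum [bar 2, bar u])) ∧
    (∑ p ∈ posPairs (w - 1), eulerSum [bar p.1, bar 1, pl p.2] =
      eulerSum [bar 1, bar 1, bar u] + eulerSum [pl 2, bar u] + eulerSum [bar v, bar 1]) ∧
    (∑ p ∈ posPairs (w - 1), eulerSum [bar p.1, pl 1, bar p.2] =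
      eulerSum [bar 1, pl u, pl 1] + eulerSum [bar 1, pl 1, pl u]
        - eulerSum [bar 1, pl u, bar 1] + eulerSum [bar v, pl 1] + eulerSum [bar 2, pl u]) ∧
    (∑ p ∈ posPairs (w - 1), eulerSum [bar p.1, pl 1, pl p.2] =
      eulerSum [bar 1, bar 1, bar u] + 2 * eulerSum [bar v, pl 1] + eulerSum [bar 1, pl v]
        - eulerSum [bar 1, bar v] - eulerSum [bar v, bar 1] - eulerSum [bar u, pl 2]
        - eulerSum [pl w]) ∧
    (∑ p ∈ posPairs (w - 1), regStar [pl p.1, pl 1, bar p.2] =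
      C (eulerSum [bar u, bar 1, bar 1]) - C (eulerSum [bar u, bar 1, pl 1])
        + regStar [pl 1, pl 1, bar u] - C (eulerSum [bar v, bar 1])
        + C (eulerSum [pl v, bar 1]) + 2 * C (eulerSum [bar v, bar 1])
        - C (eulerSum [bar v, pl 1]) - C (eulerSum [bar u, bar 2])
        + C (eulerSum [pl 2] * eulerSum [bar u]) - C (eulerSum [bar w])) ∧
    (∑ p ∈ posPairs (w - 1), regStar [pl p.1, bar 1, pl p.2] =
      2 * C (eulerSum [pl u, bar 1, bar 1]) - 2 * C (eulerSum [pl u, bar 1, pl 1])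
        + C (eulerSum [bar 1, pl 1, pl u]) + regStar [pl 1, bar 1, pl u]
        - C (eulerSum [bar 1, bar 1, pl u]) + C (eulerSum [bar v, bar 1])
        + C (eulerSum [pl v, bar 1]) + C (eulerSum [bar 1, pl v]) - C (eulerSum [bar v, pl 1])
        - C (eulerSum [bar 1, bar v]) - C (eulerSum [pl 2, pl u])
        - 2 * C (eulerSum [pl u, bar 2]) - C (eulerSum [bar w]) - C (eulerSum [pl w])) ∧
    (∑ p ∈ posPairs (w - 1), eulerSum [bar p.1, bar 1, bar p.2] =
      3 * eulerSum [pl u, bar 1, pl 1] - 3 * eulerSum [pl u, bar 1, bar 1]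
        + eulerSum [bar 1, bar 1, pl u] + 2 * eulerSum [bar v, pl 1]
        - eulerSum [bar v, bar 1] + eulerSum [pl u, bar 2] + eulerSum [pl 2, pl u]
        - eulerSum [pl u, pl 2]) := by
  obtain rfl : w = u + 2 := by lia
  obtain rfl : v = u + 1 := by lia
  have hu₂ : 2 ≤ u := by lia
  have hreg := sum_posPairs_regStar (one_le_two.trans hu₂)
  rw [show u + 2 - 1 = u + 1 by lia]
  refine ⟨?_, ?_, sum_eulerSum_bar_bar_pl hu₂, sum_eulerSum_bar_pl_bar hu₂,
    sum_eulerSum_bar_pl_pl hu₂, ?_, ?_, sum_eulerSum_bar_bar_bar hu₂⟩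
  · rw [hreg, sum_eulerSum_pl_pl_pl hu₂, C_add, add_assoc]
  · rw [hreg, sum_eulerSum_pl_bar_bar hu₂]
    simp only [C_add, C_sub]
    ring
  · rw [hreg, sum_eulerSum_pl_pl_bar hu₂]
    simp only [C_add, C_sub]
    ring
  · rw [hreg, sum_eulerSum_pl_bar_pl hu₂]
    simp only [C_add, C_sub, C_mul, C_ofNat]
    ring
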